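/- **Theorem 4.** Let $(X,\mathrm{dist})$ be a metric space. Its doubling dimension is the smallest integer $D$ such that every ball of radius $2r$ $(r>0)$ can be covered by $2^D$ balls of radius $r$ (centered in $X$). For an ordered $k$-tuple of centers $S\in X^k$, a point $p\in X$ and a finite set $P'\subseteq X$ write $\mathrm{cost}(p,S)=\min_{c\in S}\mathrm{dist}(p,c)^2$ and $\mathrm{cost}(P',S)=\sum_{p\in P'}\mathrm{cost}(p,S)$. *Sensitivity Sampling* with $m$ samples, applied to a nonempty finite set $P\subseteq X$ and an integer $k\ge 1$, works as follows. Take a $\gamma$-approximate $k$-means solution $A=(a_1,\dots,a_k)\in X^k$, i.e. $\mathrm{cost}(P,A)\le\gamma\,\mathrm{cost}(P,S)$ for all $S\in X^k$, and partition $P$ into clusters $C_1,\dots,C_k$ by assigning each point to a nearest center $a_j$ (ties broken arbitrarily). For $p\in C_j$ let $\Delta_p=\mathrm{cost}(C_j,A)/|C_j|$ and $$\mu(p)=\frac14\left(\frac1{k|C_j|}+\frac{\mathrm{cost}(p,A)}{k\,\mathrm{cost}(C_j,A)}+\frac{\mathrm{cost}(p,A)}{\mathrm{cost}(P,A)}+\frac{\Delta_p}{\mathrm{cost}(P,A)}\right),$$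 which is a probability distribution on $P$ if all clusters have positive cost; otherwise, read $0/0$ as $0$ and rescale $\mu$ to total mass $1$. Draw $q_1,\dots,q_m\in P$ independently from $\mu$ and give $q_i$ the weight $w_i=1/(m\,\mu(q_i))$. There is an absolute constant $c\in\mathbb N$ such that for every $\gamma\ge1$ and every $\delta\in(0,1)$ there is a constant $C=C(\gamma,\delta)>0$ with the following property. For every metric space $X$ of doubling dimension at most $D$, every nonempty finite $P\subseteq X$, every $k\ge1$, every $\varepsilon\in(0,1)$, every choice of the $\gamma$-approximate solution $A$ and of its clusters, and every number of samples $$m\ \ge\ C\,\frac{kD}{\varepsilon^{2}}\,\Bigl(\log\frac{2k}{\varepsilon}\Bigr)^{c},$$ the output of Sensitivity Sampling is, with probability at least $1-\delta$, an $\varepsilon$-coreset of size $m$ for $k$-means on $P$, i.e. $$\Bigl|\sum_{i=1}^m w_i\,\mathrm{cost}(q_i,S)-\mathrm{cost}(P,S)\Bigr|\le\varepsilon\,\mathrm{cost}(P,S)\qquad\text{for all } S\in X^k\text{ simultaneously.}$$ In particular, a coreset of size $\tilde O(kD/\varepsilon^2)$ suffices, where $\tilde O$ hides factors polylogarithmic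 in $k$ and $1/\varepsilon$. -/

import Mathlib

noncomputable section

namespace KMeans

/-- Every closed ball of radius `2 * r` is covered by at most `2 ^ d` closed balls of radius `r`. -/
def BallsCovered (X : Type*) [MetricSpace X] (d : ℕ) : Prop :=
  ∀ (x : X) (r : ℝ), 0 < r →
    ∃ T : Finset X, T.card ≤ 2 ^ d ∧
      Metric.closedBall x (2 * r) ⊆ ⋃ y ∈ T, Metric.closedBall y r

/-- The doubling dimension of a metric space: the smallest integer `d` such that every ball of
radius `2 * r` can be covered by `2 ^ d` balls of radius `r` (and `⊤` if there is none). -/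
def doublingDim (X : Type*) [MetricSpace X] : ℕ∞ :=
  ⨅ (d : ℕ) (_ : BallsCovered X d), (d : ℕ∞)

section
variable {X : Type*} [MetricSpace X] {k : ℕ}

/-- The squared distance of `p` to its nearest center in the ordered `k`-tuple `S`. -/
def pointCost (S : Fin k → X) (p : X) : ℝ := ⨅ j, dist p (S j) ^ 2

/-- The `k`-means cost of a finite set of points. -/
def cost (P : Finset X) (S : Fin k → X) : ℝ := ∑ p ∈ P, pointCost S p

/-- `A` is a `γ`-approximate `k`-means solution for `P`; the centers range over all of `X`. -/
def IsApproxSolution (γ : ℝ) (P : Finset X) (A : Fin k → X) : Prop :=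
  ∀ S : Fin k → X, cost P A ≤ γ * cost P S

/-- `σ` assigns every point of `P` to a nearest center of `A` (ties are broken arbitrarily). -/
def IsNearestAssignment (P : Finset X) (A : Fin k → X) (σ : X → Fin k) : Prop :=
  ∀ p ∈ P, ∀ j, dist p (A (σ p)) ≤ dist p (A j)

/-- The cluster of the points of `P` that are assigned to the center with index `j`. -/
def cluster (P : Finset X) (σ : X → Fin k) (j : Fin k) : Finset X := P.filter fun p => σ p = j

/-- The average cost of a point in the cluster of `p`. -/
def avgCost (P : Finset X) (A : Fin k → X) (σ : X → Fin k) (p : X) : ℝ :=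
  cost (cluster P σ (σ p)) A / ((cluster P σ (σ p)).card : ℝ)

/-- The score that sensitivity sampling gives to a point. A quotient with denominator `0`
(which occurs for clusters of cost `0`) counts as `0`. -/
def score (P : Finset X) (A : Fin k → X) (σ : X → Fin k) (p : X) : ℝ :=
  1 / 4 * (1 / ((k : ℝ) * ((cluster P σ (σ p)).card : ℝ))
    + pointCost A p / ((k : ℝ) * cost (cluster P σ (σ p)) A)
    + pointCost A p / cost P A
    + avgCost P A σ p / cost P A)

/-- The sampling distribution on `P`. The scores sum to `1` if all `k` clusters have positive
cost (see `sum_score`), and then this is the score itself; otherwise they are rescaled to sum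
to `1`. -/
def samplingProb (P : Finset X) (A : Fin k → X) (σ : X → Fin k) (p : X) : ℝ :=
  score P A σ p / ∑ x ∈ P, score P A σ x

/-- The probability of the event `E` for a sample of `m` independent points of `P`, each drawn
from the sampling distribution. -/
def sampleProbability (P : Finset X) (A : Fin k → X) (σ : X → Fin k) (m : ℕ)
    (E : Set (Fin m → P)) : ℝ :=
  ∑ q : Fin m → P, E.indicator (fun q => ∏ i, samplingProb P A σ (q i)) q

/-- The weight `1 / (m * μ(p))` of a sampled point. -/
def sampleWeight (P : Finset X) (A : Fin k → X) (σ : X → Fin k) (m : ℕ) (p : X) : ℝ :=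
  1 / ((m : ℝ) * samplingProb P A σ p)

/-- The points `q 0, …, q (m - 1)` with weights `w 0, …, w (m - 1)` form an `ε`-coreset, of
size `m`, of `P` for `k`-means: the weighted cost is within a factor `1 ± ε` of the cost of `P`,
simultaneously for all choices of `k` centers in the space. -/
def IsCoreset (k : ℕ) (ε : ℝ) (P : Finset X) {m : ℕ} (q : Fin m → X) (w : Fin m → ℝ) : Prop :=
  ∀ S : Fin k → X, |(∑ i, w i * pointCost S (q i)) - cost P S| ≤ ε * cost P S

/-- The scores form a probability distribution if every cluster has positive cost. -/
theorem sum_score (hk : 1 ≤ k) (P : Finset X) (A : Fin k → X) (σ : X → Fin k)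
    (h : ∀ j, 0 < cost (cluster P σ j) A) : ∑ p ∈ P, score P A σ p = 1 := by
  have hk0 : (k : ℝ) ≠ 0 := by positivity
  have hcard : ∀ j, ((cluster P σ j).card : ℝ) ≠ 0 := by
    intro j hj
    have h0 : cluster P σ j = ∅ := by simpa using hj
    have := h j
    simp [h0, cost] at this
  have hsum : ∀ f : X → ℝ, ∑ p ∈ P, f p = ∑ j, ∑ p ∈ cluster P σ j, f p := fun f =>
    (Finset.sum_fiberwise P σ f).symm
  have htot : cost P A = ∑ j, cost (cluster P σ j) A := hsum _
  have hpos : cost P A ≠ 0 := by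
    rw [htot]
    exact (Finset.sum_pos (fun j _ => h j) ⟨⟨0, hk⟩, Finset.mem_univ _⟩).ne'
  have key : ∀ j, ∑ p ∈ cluster P σ j, score P A σ p
      = 1 / 4 * (1 / k + 1 / k + cost (cluster P σ j) A / cost P A
        + cost (cluster P σ j) A / cost P A) := by
    intro j
    have e : ∀ p ∈ cluster P σ j, score P A σ p
        = 1 / 4 * (1 / ((k : ℝ) * ((cluster P σ j).card : ℝ))
          + pointCost A p / ((k : ℝ) * cost (cluster P σ j) A) + pointCost A p / cost P A
          + cost (cluster P σ j) A / ((cluster P σ j).card : ℝ) / cost P A) := by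
      intro p hp
      have hp' : σ p = j := (Finset.mem_filter.mp hp).2
      simp only [score, avgCost, hp']
    rw [Finset.sum_congr rfl e, ← Finset.mul_sum, Finset.sum_add_distrib, Finset.sum_add_distrib,
      Finset.sum_add_distrib, ← Finset.sum_div, ← Finset.sum_div, ← Finset.sum_div, Finset.sum_const,
      Finset.sum_const, nsmul_eq_mul, nsmul_eq_mul]
    have e2 : ∑ p ∈ cluster P σ j, pointCost A p = cost (cluster P σ j) A := rfl
    simp only [e2]
    have h1 := hcard j
    have h2 := (h j).ne'
    field_simp
  rw [hsum, Finset.sum_congr rfl fun j _ => key j, ← Finset.mul_sum, Finset.sum_add_distrib,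
    Finset.sum_add_distrib, ← Finset.sum_div, ← htot, Finset.sum_const, nsmul_eq_mul,
    Finset.card_univ, Fintype.card_fin]
  field_simp
  norm_num

end

end KMeans

end

open KMeans

/-! Write r for the distance of p to its center a in A and d for the distance of a to S. Then
cost(p,S) splits into d², a residual, and an error. The residual is cost(p,S) - d², cut off to 0
when r < e·d; there the dropped difference is at most 3e·d², and d² sums over P to at most
4γ·cost(P,S).

The d² part depends on the sample only through the estimated cluster sizes, which the score term
1/(k|C_j|) controls for all S at once by k tail bounds. For a fixed S the residual is handled by a
Chernoff bound (`residual_tail`). Its variance comes from |residual| ≤ 2dr + r² and the score term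
cost(p,A)/cost(P,A), and stays below O(γ²cost(P,S)²), with no loss in 1/e or k. The cut-off bounds
its range by (3/e)r², which still allows a Chernoff parameter proportional to e. So each S fails
with probability at most 2·exp(-m·e²/(544γ²)).

It remains to pass to finitely many S. Single centers are sorted into M classes
(`exists_center_classes`) by nearest center of A, by distance scale, and by cell of a cover at that
scale. The scales are quantiles of r weighted by r², so about k/e² of them suffice whatever the
spread of P. Two centers of one class are interchangeable for every point, except for an exceptional
set of cost at most (e²/k)cost(P,A). Even with the crude residual bound (3/e)r², the k exceptional
sets of a tuple contribute only O(e)cost(P,A). That the sample does not overweight them is a union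
bound over M events, not M^k, so the weaker exponent m·e²/(16k) is enough.

One nearly cheapest tuple represents each of the M^k classes of tuples. As log M = O(D log(2k/e)),
the union bound costs kD log(2k/e), which gives the sample size with a single logarithm. -/

noncomputable section

namespace KMeans

/-! ### Finite product probability and Chernoff bounds -/

section ProductProb
variable {α : Type*} [Fintype α]

/-- The probability of `E` for `m` independent samples from the probability vector `μ`. -/
def productProb (μ : α → ℝ) (m : ℕ) (E : Set (Fin m → α)) : ℝ :=
  ∑ q : Fin m → α, E.indicator (fun q => ∏ i, μ (q i)) q

variable {μ : α → ℝ} {m : ℕ}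

theorem productProb_univ (h1 : ∑ a, μ a = 1) : productProb μ m Set.univ = 1 := by
  simp only [productProb, Set.indicator_univ]
  rw [← Fintype.sum_pow, h1, one_pow]

theorem productProb_mono (h0 : ∀ a, 0 ≤ μ a) {E F : Set (Fin m → α)} (h : E ⊆ F) :
    productProb μ m E ≤ productProb μ m F :=
  Finset.sum_le_sum fun _ _ => Set.indicator_le_indicator_of_subset h
    (fun _ => Finset.prod_nonneg fun _ _ => h0 _) _

theorem productProb_union_le (h0 : ∀ a, 0 ≤ μ a) (E F : Set (Fin m → α)) :
    productProb μ m (E ∪ F) ≤ productProb μ m E + productProb μ m F := by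
  simp only [productProb, ← Finset.sum_add_distrib]
  refine Finset.sum_le_sum fun q _ => ?_
  have hq : 0 ≤ ∏ i, μ (q i) := Finset.prod_nonneg fun _ _ => h0 _
  by_cases hE : q ∈ E <;> by_cases hF : q ∈ F <;> simp [hE, hF, hq]

theorem productProb_iUnion_le (h0 : ∀ a, 0 ≤ μ a) {ι : Type*} [Fintype ι]
    (E : ι → Set (Fin m → α)) {b : ℝ} (hb : ∀ i, productProb μ m (E i) ≤ b) :
    productProb μ m (⋃ i, E i) ≤ Fintype.card ι * b := by
  have h : productProb μ m (⋃ i, E i) ≤ ∑ i, productProb μ m (E i) := by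
    simp only [productProb]
    rw [Finset.sum_comm]
    refine Finset.sum_le_sum fun q _ => ?_
    have hq : 0 ≤ ∏ i, μ (q i) := Finset.prod_nonneg fun _ _ => h0 _
    have hn : ∀ i, 0 ≤ (E i).indicator (fun q => ∏ i, μ (q i)) q := fun i =>
      Set.indicator_apply_nonneg fun _ => hq
    by_cases hE : q ∈ ⋃ i, E i
    · obtain ⟨i, hi⟩ := Set.mem_iUnion.1 hE
      rw [Set.indicator_of_mem hE]
      refine le_trans (le_of_eq ?_)
        (Finset.single_le_sum (fun i _ => hn i) (Finset.mem_univ i))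
      rw [Set.indicator_of_mem hi]
    · rw [Set.indicator_of_notMem hE]
      exact Finset.sum_nonneg fun i _ => hn i
  refine h.trans ((Finset.sum_le_sum fun i _ => hb i).trans ?_)
  simp

theorem one_sub_le_productProb (h0 : ∀ a, 0 ≤ μ a) (h1 : ∑ a, μ a = 1) {E B : Set (Fin m → α)}
    (h : Eᶜ ⊆ B) : 1 - productProb μ m B ≤ productProb μ m E := by
  have h2 : productProb μ m (E ∪ Eᶜ) = 1 := by rw [Set.union_compl_self, productProb_univ h1]
  have h3 := productProb_union_le h0 E Eᶜ
  have h4 := productProb_mono h0 h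
  linarith

theorem exp_le_one_add_add_sq {x : ℝ} (hx : |x| ≤ 1) : Real.exp x ≤ 1 + x + x ^ 2 := by
  have := Real.abs_exp_sub_one_sub_id_le hx
  have := (abs_le.1 this).2
  linarith

/-- Chernoff's bound for the upper tail of an importance sampling estimate. -/
theorem productProb_upper_tail (hμ : ∀ a, 0 < μ a) (h1 : ∑ a, μ a = 1) (f : α → ℝ)
    {l t V : ℝ} (hl : 0 ≤ l) (hb : ∀ a, |l * f a| ≤ μ a) (hV : ∑ a, f a ^ 2 / μ a ≤ V) :
    productProb μ m {q | ∑ a, f a + t < ∑ i, 1 / (m * μ (q i)) * f (q i)}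
      ≤ Real.exp (m * (l ^ 2 * V - l * t)) := by
  set F := ∑ a, f a with hF
  have hmgf : ∑ a, Real.exp (l * (f a / μ a)) * μ a ≤ Real.exp (l * F + l ^ 2 * V) := by
    have h2 : ∀ a, Real.exp (l * (f a / μ a)) * μ a
        ≤ μ a + l * f a + l ^ 2 * (f a ^ 2 / μ a) := by
      intro a
      have ha := hμ a
      have h3 : |l * (f a / μ a)| ≤ 1 := by
        rw [← mul_div_assoc, abs_div, abs_of_pos ha, div_le_one ha]
        exact hb a
      refine (mul_le_mul_of_nonneg_right (exp_le_one_add_add_sq h3) ha.le).trans (le_of_eq ?_)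
      field_simp
    refine (Finset.sum_le_sum fun a _ => h2 a).trans ?_
    rw [Finset.sum_add_distrib, Finset.sum_add_distrib, h1, ← Finset.mul_sum, ← Finset.mul_sum,
      ← hF]
    have h4 := Real.add_one_le_exp (l * F + l ^ 2 * V)
    have h5 := mul_le_mul_of_nonneg_left hV (sq_nonneg l)
    linarith
  have hpt : ∀ q : Fin m → α,
      {q : Fin m → α | F + t < ∑ i, 1 / (m * μ (q i)) * f (q i)}.indicator
        (fun q => ∏ i, μ (q i)) q
      ≤ Real.exp (-(m * (l * (F + t)))) * ∏ i, (Real.exp (l * (f (q i) / μ (q i))) * μ (q i)) := by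
    intro q
    have hq : 0 ≤ ∏ i, μ (q i) := Finset.prod_nonneg fun _ _ => (hμ _).le
    rw [Finset.prod_mul_distrib, ← mul_assoc, ← Real.exp_sum, ← Real.exp_add]
    by_cases hE : q ∈ {q : Fin m → α | F + t < ∑ i, 1 / (m * μ (q i)) * f (q i)}
    · rw [Set.indicator_of_mem hE]
      refine le_mul_of_one_le_left hq (Real.one_le_exp ?_)
      rw [← Finset.mul_sum]
      rcases Nat.eq_zero_or_pos m with hm | hm
      · subst hm; simp
      · have hm' : (0 : ℝ) < m := by exact_mod_cast hm
        have h6 : ∑ i, f (q i) / μ (q i) = m * ∑ i, 1 / (m * μ (q i)) * f (q i) := by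
          rw [Finset.mul_sum]
          refine Finset.sum_congr rfl fun i _ => ?_
          have := (hμ (q i)).ne'
          field_simp
        rw [h6]
        have h7 : F + t < ∑ i, 1 / (m * μ (q i)) * f (q i) := hE
        have h8 := mul_le_mul_of_nonneg_left h7.le (mul_nonneg hm'.le hl)
        linarith
    · rw [Set.indicator_of_notMem hE]
      positivity
  refine (Finset.sum_le_sum fun q _ => hpt q).trans ?_
  rw [← Finset.mul_sum, ← Fintype.sum_pow (fun a => Real.exp (l * (f a / μ a)) * μ a)]
  have h9 : (∑ a, Real.exp (l * (f a / μ a)) * μ a) ^ m ≤ Real.exp (l * F + l ^ 2 * V) ^ m :=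
    pow_le_pow_left₀ (Finset.sum_nonneg fun a _ => by have := hμ a; positivity) hmgf m
  refine (mul_le_mul_of_nonneg_left h9 (Real.exp_pos _).le).trans (le_of_eq ?_)
  rw [← Real.exp_nat_mul, ← Real.exp_add]
  congr 1
  ring

/-- A two-sided tail bound for an importance sampling estimate. -/
theorem productProb_abs_tail (hμ : ∀ a, 0 < μ a) (h1 : ∑ a, μ a = 1) (f : α → ℝ)
    {l t V : ℝ} (hl : 0 ≤ l) (hb : ∀ a, |l * f a| ≤ μ a) (hV : ∑ a, f a ^ 2 / μ a ≤ V)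
    (ht : l * V ≤ t / 2) :
    productProb μ m {q | t < |∑ i, 1 / (m * μ (q i)) * f (q i) - ∑ a, f a|}
      ≤ 2 * Real.exp (-(m * (l * t / 2))) := by
  have h0 : ∀ a, 0 ≤ μ a := fun a => (hμ a).le
  have hup := productProb_upper_tail (m := m) (t := t) hμ h1 f hl hb hV
  have hlo := productProb_upper_tail (m := m) (t := t) hμ h1 (fun a => -f a) hl
    (by intro a; rw [mul_neg, abs_neg]; exact hb a) (V := V) (by simpa using hV)
  -- The assumption l·V ≤ t/2 lets half of the linear term absorb the quadratic one.
  have hexp : Real.exp (m * (l ^ 2 * V - l * t)) ≤ Real.exp (-(m * (l * t / 2))) := by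
    apply Real.exp_le_exp.2
    have := mul_le_mul_of_nonneg_left (mul_le_mul_of_nonneg_left ht hl) (Nat.cast_nonneg (α := ℝ) m)
    nlinarith
  have hsub : {q : Fin m → α | t < |∑ i, 1 / (m * μ (q i)) * f (q i) - ∑ a, f a|} ⊆
      {q | ∑ a, f a + t < ∑ i, 1 / (m * μ (q i)) * f (q i)} ∪
      {q | ∑ a, -f a + t < ∑ i, 1 / (m * μ (q i)) * -f (q i)} := by
    intro q hq
    rcases lt_abs.1 (show t < |_| from hq) with h | h
    · left
      rw [Set.mem_ofPred_eq]
      linarith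
    · right
      simp only [Set.mem_ofPred_eq, mul_neg, Finset.sum_neg_distrib]
      linarith
  refine (productProb_mono h0 hsub).trans ((productProb_union_le h0 _ _).trans ?_)
  linarith

end ProductProb

/-! ### Covers in doubling spaces -/

section Covering
variable {X : Type*} [MetricSpace X]

theorem BallsCovered.mono {d D : ℕ} (h : BallsCovered X d) (hd : d ≤ D) : BallsCovered X D := by
  intro x r hr
  obtain ⟨T, hT, hc⟩ := h x r hr
  exact ⟨T, hT.trans (Nat.pow_le_pow_right (by norm_num) hd), hc⟩

theorem ballsCovered_of_doublingDim_le {D : ℕ} (h : doublingDim X ≤ D) : BallsCovered X D := by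
  by_contra hD
  -- Admissibility is upward closed, so if D fails then so does every smaller exponent.
  have h2 : ((D + 1 : ℕ) : ℕ∞) ≤ doublingDim X := by
    refine le_iInf₂ fun d hd => ?_
    by_contra hlt
    have : ¬ D + 1 ≤ d := fun h => hlt (by exact_mod_cast h)
    exact hD (hd.mono (by omega))
  have h3 := h2.trans h
  have : D + 1 ≤ D := by exact_mod_cast h3
  omega

theorem BallsCovered.iterate {D : ℕ} (h : BallsCovered X D) (n : ℕ) (x : X) {R : ℝ} (hR : 0 < R) :
    ∃ T : Finset X, T.card ≤ 2 ^ (D * n) ∧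
      Metric.closedBall x R ⊆ ⋃ y ∈ T, Metric.closedBall y (R / 2 ^ n) := by
  classical
  induction n with
  | zero => exact ⟨{x}, by simp, by simp⟩
  | succ n ih =>
    obtain ⟨T, hT, hc⟩ := ih
    have hr : 0 < R / 2 ^ (n + 1) := by positivity
    choose U hU hUc using fun y => h y _ hr
    refine ⟨T.biUnion U, ?_, fun z hz => ?_⟩
    · refine (Finset.card_biUnion_le_card_mul _ _ _ fun y _ => hU y).trans ?_
      rw [Nat.mul_succ, pow_add]
      exact Nat.mul_le_mul_right _ hT
    · obtain ⟨y, hy, hzy⟩ := Set.mem_iUnion₂.1 (hc hz)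
      have : z ∈ Metric.closedBall y (2 * (R / 2 ^ (n + 1))) := by
        have e : 2 * (R / 2 ^ (n + 1)) = R / 2 ^ n := by rw [pow_succ]; field_simp
        rwa [e]
      obtain ⟨u, hu, hzu⟩ := Set.mem_iUnion₂.1 (hUc y this)
      exact Set.mem_iUnion₂.2 ⟨u, Finset.mem_biUnion.2 ⟨y, hy, hu⟩, hzu⟩

/-- In a doubling space there is a cover of a ball that is indexed by `Fin`. -/
theorem BallsCovered.exists_cover {D : ℕ} (h : BallsCovered X D) (n : ℕ) (x : X) {R : ℝ}
    (hR : 0 ≤ R) :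
    ∃ c : Fin (2 ^ (D * n)) → X, ∀ z, dist z x ≤ R → ∃ i, dist z (c i) ≤ R / 2 ^ n := by
  rcases hR.eq_or_lt with rfl | hR
  · exact ⟨fun _ => x, fun z hz => ⟨⟨0, by positivity⟩, by simpa using hz⟩⟩
  · obtain ⟨T, hT, hc⟩ := h.iterate n x hR
    have : Nonempty X := ⟨x⟩
    let e := T.equivFin.symm
    -- Surplus indices are padded with x, so that the index type does not depend on the ball.
    refine ⟨fun i => if hi : i.1 < T.card then e ⟨i, hi⟩ else x, fun z hz => ?_⟩
    obtain ⟨y, hy, hzy⟩ := Set.mem_iUnion₂.1 (hc (Metric.mem_closedBall.2 hz))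
    let i := T.equivFin ⟨y, hy⟩
    refine ⟨⟨i, i.2.trans_le hT⟩, ?_⟩
    simpa [e, i] using hzy

/-- A single ball of radius d/4 would have to contain two points at distance d. This settles D = 0,
where the required sample size is 0. -/
theorem BallsCovered.subsingleton (h : BallsCovered X 0) (x y : X) : x = y := by
  by_contra hxy
  have hd : 0 < dist x y := dist_pos.2 hxy
  obtain ⟨c, hc⟩ := h.exists_cover 2 y hd.le
  obtain ⟨i, hi⟩ := hc x le_rfl
  obtain ⟨j, hj⟩ := hc y (by simp)
  have hij : i = j := by ext; have := i.2; have := j.2; simp at *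
  subst hij
  have := dist_triangle_right x y (c i)
  norm_num at hi hj
  linarith

end Covering

/-! ### Quantile thresholds -/

/-- A finite nonnegative mass on the line can be cut at few thresholds `t i` such that the mass
between consecutive thresholds, on the exceptional sets `E i`, is small. -/
theorem exists_quantiles {X : Type*} (P : Finset X) (r v : X → ℝ) (hr : ∀ p, 0 ≤ r p)
    (hv : ∀ p, 0 ≤ v p) (hV : 0 < ∑ p ∈ P, v p) {N : ℕ} (hN : 0 < N) :
    ∃ (level : ℝ → Fin (N + 1)) (t : Fin (N + 1) → ℝ) (E : Fin (N + 1) → Finset X),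
      (∀ i, 0 ≤ t i) ∧ (∀ i, E i ⊆ P) ∧ (∀ i, ∑ p ∈ E i, v p ≤ (∑ p ∈ P, v p) / N) ∧
      ∀ i, ∀ p ∈ P, p ∉ E i → (∀ x, level x = i → r p < x) ∨
        (t i ≤ r p ∧ ∀ x, level x = i → x ≤ t i) := by
  classical
  set V := ∑ p ∈ P, v p with hVdef
  have hN' : (0 : ℝ) < N := by exact_mod_cast hN
  let F : ℝ → ℝ := fun x => ∑ p ∈ P with x ≤ r p, v p
  have hFanti : ∀ {x y}, x ≤ y → F y ≤ F x := fun {x y} hxy =>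
    Finset.sum_le_sum_of_subset_of_nonneg
      (fun p hp => by simp only [Finset.mem_filter] at hp ⊢; exact ⟨hp.1, hxy.trans hp.2⟩)
      fun p _ _ => hv p
  have hF0 : ∀ x, 0 ≤ F x := fun x => Finset.sum_nonneg fun p _ => hv p
  have hFV : ∀ x, F x ≤ V := fun x =>
    Finset.sum_le_sum_of_subset_of_nonneg (Finset.filter_subset _ _) fun p _ _ => hv p
  have hFx : ∀ x, 0 < F x → ∃ p ∈ P, x ≤ r p ∧ F (r p) = F x := by
    intro x hx
    have hne : (P.filter fun p => x ≤ r p).Nonempty := by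
      by_contra hne
      rw [Finset.not_nonempty_iff_eq_empty] at hne
      have : F x = 0 := by simp only [F, hne, Finset.sum_empty]
      exact hx.ne' this
    obtain ⟨p, hp, hmin⟩ := Finset.exists_min_image _ r hne
    rw [Finset.mem_filter] at hp
    refine ⟨p, hp.1, hp.2, le_antisymm (hFanti hp.2) ?_⟩
    refine Finset.sum_le_sum_of_subset_of_nonneg (fun q hq => ?_) fun q _ _ => hv q
    exact Finset.mem_filter.2 ⟨(Finset.mem_filter.1 hq).1, hmin q hq⟩
  -- F is the mass at radius at least x; a level is a band of F of height V/N.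
  let lev : ℝ → ℕ := fun x => ⌊N * F x / V⌋₊
  have hlev : ∀ x, lev x < N + 1 := by
    intro x
    have : N * F x / V ≤ N := by
      rw [div_le_iff₀ hV]; exact mul_le_mul_of_nonneg_left (hFV x) hN'.le
    exact Nat.lt_succ_of_le (Nat.floor_le_of_le this)
  have hlev1 : ∀ x, (lev x : ℝ) * V ≤ N * F x := by
    intro x
    have h := Nat.floor_le (a := N * F x / V) (by have := hF0 x; positivity)
    exact (le_div_iff₀ hV).1 h
  have hlev2 : ∀ x, N * F x < ((lev x : ℝ) + 1) * V := by
    intro x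
    exact (div_lt_iff₀ hV).1 (Nat.lt_floor_add_one (N * F x / V))
  let Q : ℕ → Finset X := fun i => P.filter fun p => (i : ℝ) * V ≤ N * F (r p)
  have ht : ∀ i : ℕ, ∃ t : ℝ, 0 ≤ t ∧ ((Q i).Nonempty → ∃ p ∈ Q i, t = r p) ∧
      ∀ p ∈ Q i, r p ≤ t := by
    intro i
    by_cases hne : (Q i).Nonempty
    · obtain ⟨p, hp, hmax⟩ := Finset.exists_max_image _ r hne
      exact ⟨r p, hr p, fun _ => ⟨p, hp, rfl⟩, hmax⟩
    · refine ⟨0, le_rfl, fun h => absurd h hne, fun p hp => absurd ⟨p, hp⟩ hne⟩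
  choose t ht0 htmem htmax using ht
  -- For i > 0 these are the points of level i strictly inside t i, the largest data radius of level
  -- at least i. Level 0 also contains radii beyond all data, so no threshold bounds it and all its
  -- points are exceptional.
  let E : ℕ → Finset X := fun i => P.filter fun p =>
    N * F (r p) < ((i : ℝ) + 1) * V ∧ (i = 0 ∨ ((Q i).Nonempty ∧ r p < t i))
  refine ⟨fun x => ⟨lev x, hlev x⟩, fun i => t i, fun i => E i, fun i => ht0 i,
    fun i => Finset.filter_subset _ _, fun i => ?_, fun i p hp hpE => ?_⟩
  · obtain ⟨i, -⟩ := i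
    show ∑ p ∈ E i, v p ≤ V / N
    rw [le_div_iff₀ hN']
    rcases (E i).eq_empty_or_nonempty with hE | hE
    · rw [hE]; simpa using hV.le
    obtain ⟨y, hy, hmin⟩ := Finset.exists_min_image _ r hE
    have hy' := (Finset.mem_filter.1 hy).2
    rcases Nat.eq_zero_or_pos i with hi | hi
    · subst hi
      have h1 : ∑ p ∈ E 0, v p ≤ F (r y) :=
        Finset.sum_le_sum_of_subset_of_nonneg (fun q hq => Finset.mem_filter.2
          ⟨(Finset.mem_filter.1 hq).1, hmin q hq⟩) fun q _ _ => hv q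
      have h2 := hy'.1
      norm_num at h2
      nlinarith
    · have h3 := hy'.2.resolve_left hi.ne'
      obtain ⟨q, hq, hqt⟩ := htmem i h3.1
      have hFt : (i : ℝ) * V ≤ N * F (t i) := by rw [hqt]; exact (Finset.mem_filter.1 hq).2
      have hdisj : Disjoint (E i) (P.filter fun p => t i ≤ r p) := by
        rw [Finset.disjoint_left]
        intro z hz hz2
        have := ((Finset.mem_filter.1 hz).2.2.resolve_left hi.ne').2
        exact absurd (Finset.mem_filter.1 hz2).2 (not_le.2 this)
      -- The exceptional mass is a difference of two values of F lying in the same band.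
      have h4 : ∑ p ∈ E i, v p + F (t i) ≤ F (r y) := by
        show ∑ p ∈ E i, v p + ∑ p ∈ P with t i ≤ r p, v p ≤ F (r y)
        rw [← Finset.sum_union hdisj]
        refine Finset.sum_le_sum_of_subset_of_nonneg (fun z hz => ?_) fun q _ _ => hv q
        rcases Finset.mem_union.1 hz with hz | hz
        · exact Finset.mem_filter.2 ⟨(Finset.mem_filter.1 hz).1, hmin z hz⟩
        · exact Finset.mem_filter.2 ⟨(Finset.mem_filter.1 hz).1,
            h3.2.le.trans (Finset.mem_filter.1 hz).2⟩
      have h5 := hy'.1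
      nlinarith
  · obtain ⟨i, hiN⟩ := i
    have hlevi : ∀ x, (⟨lev x, hlev x⟩ : Fin (N + 1)) = ⟨i, hiN⟩ → lev x = i := fun x h =>
      congrArg Fin.val h
    by_cases h1 : N * F (r p) < ((i : ℝ) + 1) * V
    · have h2 : ¬ (i = 0 ∨ ((Q i).Nonempty ∧ r p < t i)) := fun h =>
        hpE (Finset.mem_filter.2 ⟨hp, h1, h⟩)
      rw [not_or] at h2
      obtain ⟨hi, h2⟩ := h2
      have key : ∀ x, lev x = i → (Q i).Nonempty ∧ x ≤ t i := by
        intro x hx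
        have h3 := hlev1 x
        rw [hx] at h3
        have hi' : (0 : ℝ) < i := by exact_mod_cast Nat.pos_of_ne_zero hi
        -- Positive tail mass puts a data radius with the same tail mass at or beyond x, hence x ≤ t
        -- i.
        have h4 : 0 < F x := by
          have : 0 < (i : ℝ) * V := by positivity
          by_contra hneg
          have := hF0 x
          have h0 : F x = 0 := le_antisymm (not_lt.1 hneg) this
          rw [h0] at h3
          linarith
        obtain ⟨y, hy, hxy, hFy⟩ := hFx x h4
        have hyQ : y ∈ Q i := Finset.mem_filter.2 ⟨hy, by rw [hFy]; exact h3⟩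
        exact ⟨⟨y, hyQ⟩, hxy.trans (htmax i y hyQ)⟩
      by_cases hQ : (Q i).Nonempty
      · right
        exact ⟨not_lt.1 fun h => h2 ⟨hQ, h⟩, fun x hx => (key x (hlevi x hx)).2⟩
      · left
        intro x hx
        exact absurd (key x (hlevi x hx)).1 hQ
    · left
      intro x hx
      by_contra hlt
      have h3 := hFanti (not_lt.1 hlt)
      have h4 := hlev2 x
      rw [hlevi x hx] at h4
      have h5 := mul_le_mul_of_nonneg_left h3 hN'.le
      linarith

/-! ### Distance to the nearest center -/

section MinDist
variable {X : Type*} [MetricSpace X] {k : ℕ}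

/-- The distance of a point to its nearest center. -/
def minDist (S : Fin k → X) (x : X) : ℝ := ⨅ j, dist x (S j)

theorem minDist_le (S : Fin k → X) (x : X) (j : Fin k) : minDist S x ≤ dist x (S j) :=
  ciInf_le (Set.finite_range _).bddBelow j

variable [NeZero k]

theorem exists_minDist_eq (S : Fin k → X) (x : X) : ∃ j, minDist S x = dist x (S j) := by
  obtain ⟨j, hj⟩ := exists_eq_ciInf_of_finite (f := fun j => dist x (S j))
  exact ⟨j, hj.symm⟩

theorem minDist_nonneg (S : Fin k → X) (x : X) : 0 ≤ minDist S x := by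
  obtain ⟨j, hj⟩ := exists_minDist_eq S x
  rw [hj]; exact dist_nonneg

theorem le_minDist {S : Fin k → X} {x : X} {b : ℝ} (h : ∀ j, b ≤ dist x (S j)) :
    b ≤ minDist S x := le_ciInf h

theorem pointCost_eq (S : Fin k → X) (x : X) : pointCost S x = minDist S x ^ 2 := by
  refine le_antisymm ?_ (le_ciInf fun j => ?_)
  · obtain ⟨j, hj⟩ := exists_minDist_eq S x
    rw [hj]
    exact ciInf_le (Set.finite_range _).bddBelow j
  · exact pow_le_pow_left₀ (minDist_nonneg S x) (minDist_le S x j) 2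

theorem pointCost_nonneg (S : Fin k → X) (x : X) : 0 ≤ pointCost S x := by
  rw [pointCost_eq]; positivity

theorem cost_nonneg (P : Finset X) (S : Fin k → X) : 0 ≤ cost P S :=
  Finset.sum_nonneg fun _ _ => pointCost_nonneg S _

theorem minDist_le_add (S : Fin k → X) (x y : X) : minDist S x ≤ minDist S y + dist x y := by
  obtain ⟨j, hj⟩ := exists_minDist_eq S y
  have := minDist_le S x j
  have := dist_triangle x y (S j)
  linarith

theorem abs_minDist_sq_sub_le (S : Fin k → X) (x y : X) :
    |minDist S x ^ 2 - minDist S y ^ 2| ≤ 2 * minDist S y * dist x y + dist x y ^ 2 := by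
  have h1 := minDist_le_add S x y
  have h2 := minDist_le_add S y x
  rw [dist_comm y x] at h2
  have h3 := minDist_nonneg S x
  have h4 := minDist_nonneg S y
  have h5 : 0 ≤ dist x y := dist_nonneg
  rw [abs_le]
  constructor
  · rcases le_total (minDist S y) (dist x y) with h | h
    · nlinarith
    · nlinarith
  · nlinarith

theorem pointCost_of_isNearest {P : Finset X} {A : Fin k → X} {σ : X → Fin k}
    (hσ : IsNearestAssignment P A σ) {p : X} (hp : p ∈ P) :
    pointCost A p = dist p (A (σ p)) ^ 2 := by
  rw [pointCost_eq, le_antisymm (minDist_le A p (σ p)) (le_minDist (hσ p hp))]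

/-- A center farther than M cannot realize a minimum that is at most M, so only the pairs within b
of each other matter. -/
theorem abs_minDist_sub_le_of_close {S S' : Fin k → X} {z : X} {M b : ℝ} (hM : minDist S z ≤ M)
    (hM' : minDist S' z ≤ M)
    (h : ∀ l, dist (S l) (S' l) ≤ b ∨ M < dist z (S l) ∧ M < dist z (S' l)) :
    |minDist S z - minDist S' z| ≤ b := by
  have key : ∀ T T' : Fin k → X, minDist T z ≤ M →
      (∀ l, dist (T l) (T' l) ≤ b ∨ M < dist z (T l) ∧ M < dist z (T' l)) →
      minDist T' z ≤ minDist T z + b := by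
    intro T T' hT hTT
    obtain ⟨l, hl⟩ := exists_minDist_eq T z
    rcases hTT l with h | h
    · have := minDist_le T' z l
      have := dist_triangle z (T l) (T' l)
      linarith
    · linarith [h.1]
  have h1 := key S S' hM h
  have h2 := key S' S hM' fun l => by
    rw [dist_comm (S' l)]; exact (h l).imp id And.symm
  rw [abs_le]
  constructor <;> linarith

end MinDist

/-! ### Classes of indistinguishable centers -/

section Classes
variable {X : Type*} [MetricSpace X] {k : ℕ} [NeZero k]

/-- The centers fall into few classes such that two centers of the same class have nearly the same
distances to all points outside a set of small cost. -/
theorem exists_center_classes {D : ℕ} (hX : BallsCovered X D) (P : Finset X) (A : Fin k → X)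
    (r : X → ℝ) (hr : ∀ p, 0 ≤ r p) (hV : 0 < ∑ p ∈ P, r p ^ 2) {e : ℝ} (he : 0 < e)
    {N n : ℕ} (hN : 0 < N) (hn : 6 / e ^ 3 ≤ 2 ^ n) :
    ∃ (θ : X → Fin k × Fin (N + 1) × Fin (2 ^ (D * n)))
      (E : Fin k × Fin (N + 1) × Fin (2 ^ (D * n)) → Finset X),
      (∀ a, E a ⊆ P) ∧ (∀ a, ∑ p ∈ E a, r p ^ 2 ≤ (∑ p ∈ P, r p ^ 2) / N) ∧
      ∀ s s', θ s = θ s' → ∀ p ∈ P, p ∉ E (θ s) →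
        dist s s' ≤ e ^ 2 * r p ∨
          (3 * r p < e * minDist A s ∧ 3 * r p < e * minDist A s') := by
  classical
  obtain ⟨level, t, E, ht, hEP, hE, hlev⟩ :=
    exists_quantiles P r (fun p => r p ^ 2) hr (fun p => sq_nonneg _) hV hN
  have hcov : ∀ (j : Fin k) (i : Fin (N + 1)), ∃ c : Fin (2 ^ (D * n)) → X,
      ∀ z, dist z (A j) ≤ 3 * t i / e → ∃ u, dist z (c u) ≤ 3 * t i / e / 2 ^ n := fun j i =>
    hX.exists_cover n (A j) (by have := ht i; positivity)
  choose c hc using hcov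
  choose near hnear using fun s => exists_minDist_eq A s
  have hcell : ∀ (j : Fin k) (i : Fin (N + 1)) (s : X), ∃ u : Fin (2 ^ (D * n)),
      dist s (A j) ≤ 3 * t i / e → dist s (c j i u) ≤ 3 * t i / e / 2 ^ n := by
    intro j i s
    by_cases h : dist s (A j) ≤ 3 * t i / e
    · obtain ⟨u, hu⟩ := hc j i s h
      exact ⟨u, fun _ => hu⟩
    · exact ⟨⟨0, by positivity⟩, fun h' => absurd h' h⟩
  choose cell hcell using hcell
  -- The level is taken at e/3 times the distance to A. A point with r below it sees s as far away;
  -- a point with r at or above the threshold t i has s in the covered ball of radius 3·t i/e, whose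
  -- cells have radius at most e²·t i/2.
  refine ⟨fun s => (near s, level (e * minDist A s / 3),
    cell (near s) (level (e * minDist A s / 3)) s), fun a => E a.2.1, fun a => hEP _,
    fun a => hE _, fun s s' hss p hp hpE => ?_⟩
  simp only [Prod.mk.injEq] at hss
  obtain ⟨h1, h2, h3⟩ := hss
  rcases hlev _ p hp hpE with h | ⟨h4, h5⟩
  · right
    have := h _ rfl
    have := h _ h2.symm
    constructor <;> linarith
  · left
    have h6 := h5 _ rfl
    have h7 := h5 _ h2.symm
    rw [← h1, ← h2] at h3
    set i := level (e * minDist A s / 3)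
    have b1 : dist s (A (near s)) ≤ 3 * t i / e := by
      rw [le_div_iff₀ he, ← hnear]; linarith
    have b2 : dist s' (A (near s)) ≤ 3 * t i / e := by
      rw [h1, le_div_iff₀ he, ← hnear]; linarith
    have c1 := hcell _ _ _ b1
    have c2 := hcell _ _ _ b2
    rw [← h3] at c2
    have h8 := dist_triangle_right s s' (c (near s) i (cell (near s) i s))
    have h9 : 3 * t i / e / 2 ^ n ≤ e ^ 2 * t i / 2 := by
      have h10 : 6 ≤ 2 ^ n * e ^ 3 := (div_le_iff₀ (by positivity)).1 hn
      rw [div_div, div_le_iff₀ (by positivity)]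
      have := mul_le_mul_of_nonneg_right h10 (ht i)
      linarith
    have h11 := mul_le_mul_of_nonneg_left h4 (sq_nonneg e)
    linarith

end Classes

/-! ### Residuals and their stability -/

section Residual
variable {X : Type*} [MetricSpace X] {k : ℕ} [NeZero k]

/-- The difference between the cost of a point and the cost of its center in `A`, set to `0` if the
center of `A` is much closer to the point than to `S`. -/
def residual (e : ℝ) (A : Fin k → X) (σ : X → Fin k) (S : Fin k → X) (p : X) : ℝ :=
  if e * minDist S (A (σ p)) ≤ dist p (A (σ p)) then
    pointCost S p - minDist S (A (σ p)) ^ 2 else 0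

variable {e : ℝ} {A : Fin k → X} {σ : X → Fin k}

theorem abs_residual_le (S : Fin k → X) (p : X) :
    |residual e A σ S p| ≤ 2 * minDist S (A (σ p)) * dist p (A (σ p)) + dist p (A (σ p)) ^ 2 := by
  unfold residual
  split_ifs
  · rw [pointCost_eq]; exact abs_minDist_sq_sub_le S p _
  · rw [abs_zero]; have := minDist_nonneg S (A (σ p)); positivity

/-- Where the residual survives the cut-off, d ≤ r/e. This is the range bound for Chernoff and the
crude bound on exceptional points. -/
theorem abs_residual_le_div (he : 0 < e) (he1 : e < 1) (S : Fin k → X) (p : X) :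
    |residual e A σ S p| ≤ 3 / e * dist p (A (σ p)) ^ 2 := by
  by_cases h : e * minDist S (A (σ p)) ≤ dist p (A (σ p))
  · refine (abs_residual_le S p).trans ?_
    have hr : 0 ≤ dist p (A (σ p)) := dist_nonneg
    rw [div_mul_eq_mul_div, le_div_iff₀ he]
    nlinarith [mul_le_mul_of_nonneg_right h hr, mul_nonneg (sub_nonneg.2 he1.le) (sq_nonneg (dist p (A (σ p))))]
  · rw [residual, if_neg h, abs_zero]; positivity

theorem abs_pointCost_sub_residual_le (he : 0 < e) (he1 : e < 1) (S : Fin k → X) (p : X) :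
    |pointCost S p - minDist S (A (σ p)) ^ 2 - residual e A σ S p|
      ≤ 3 * e * minDist S (A (σ p)) ^ 2 := by
  unfold residual
  split_ifs with h
  · rw [sub_self, abs_zero]; positivity
  · rw [sub_zero, pointCost_eq]
    refine (abs_minDist_sq_sub_le S p _).trans ?_
    have hr : 0 ≤ dist p (A (σ p)) := dist_nonneg
    have hd := minDist_nonneg S (A (σ p))
    push Not at h
    nlinarith [mul_le_mul_of_nonneg_left h.le hd, mul_le_mul h.le h.le hr (by positivity),
      mul_nonneg (mul_nonneg he.le (sub_nonneg.2 he1.le)) (sq_nonneg (minDist S (A (σ p))))]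

/-- If S' is cut off at p, then r is below e times the distance of S' to the center, so the residual
for S is already within the allowed error. -/
theorem abs_residual_le_of_not {S S' : Fin k → X} {p : X} (he : 0 < e) (he1 : e < 1)
    (h' : dist p (A (σ p)) < e * minDist S' (A (σ p))) :
    |residual e A σ S p|
      ≤ 3 * e * (minDist S (A (σ p)) ^ 2 + minDist S' (A (σ p)) ^ 2) := by
  refine (abs_residual_le S p).trans ?_
  have hr : 0 ≤ dist p (A (σ p)) := dist_nonneg
  have hd := minDist_nonneg S (A (σ p))
  have hd' := minDist_nonneg S' (A (σ p))
  nlinarith [mul_le_mul_of_nonneg_left h'.le hd, mul_le_mul h'.le h'.le hr (by positivity),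
    mul_nonneg he.le (sq_nonneg (minDist S (A (σ p)) - minDist S' (A (σ p)))),
    mul_nonneg he.le (sq_nonneg (minDist S (A (σ p)))),
    mul_nonneg (mul_nonneg he.le (sub_nonneg.2 he1.le)) (sq_nonneg (minDist S' (A (σ p))))]

theorem abs_sq_sub_sq_le {x y b M : ℝ} (hx : 0 ≤ x) (hy : 0 ≤ y) (hxM : x ≤ M) (hyM : y ≤ M)
    (h : |x - y| ≤ b) : |x ^ 2 - y ^ 2| ≤ 2 * M * b := by
  have e1 : x ^ 2 - y ^ 2 = (x + y) * (x - y) := by ring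
  rw [e1, abs_mul, abs_of_nonneg (add_nonneg hx hy)]
  exact mul_le_mul (by linarith) h (abs_nonneg _) (by linarith)

/-- Residuals for centers that are indistinguishable from `p` are close to each other. -/
theorem abs_residual_sub_le {S S' : Fin k → X} {p : X} (he : 0 < e) (he1 : e < 1)
    (h : ∀ l, dist (S l) (S' l) ≤ e ^ 2 * dist p (A (σ p)) ∨
      (3 * dist p (A (σ p)) < e * minDist A (S l) ∧
        3 * dist p (A (σ p)) < e * minDist A (S' l))) :
    |residual e A σ S p - residual e A σ S' p| ≤
      3 * e * (minDist S (A (σ p)) ^ 2 + minDist S' (A (σ p)) ^ 2)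
        + 8 * e * dist p (A (σ p)) ^ 2 := by
  set a := A (σ p) with ha
  set r := dist p a with hr
  have hr0 : 0 ≤ r := dist_nonneg
  by_cases h1 : e * minDist S a ≤ r
  · by_cases h2 : e * minDist S' a ≤ r
    · rw [residual, residual, if_pos h1, if_pos h2]
      -- If neither residual is cut off, both tuples lie within 2r/e of a and of p, while a far
      -- center is beyond 3r/e - r/e from both. Only moves by at most e²r count; each squared
      -- distance changes by at most 4er², giving 8er² in total.
      have hra : r ≤ r / e := by rw [le_div_iff₀ he]; nlinarith
      have hM : ∀ T : Fin k → X, e * minDist T a ≤ r →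
          minDist T a ≤ 2 * r / e ∧ minDist T p ≤ 2 * r / e := by
        intro T hT
        have h3 : minDist T a ≤ r / e := by rw [le_div_iff₀ he]; linarith
        have h4 := minDist_le_add T p a
        have h5 : 2 * r / e = r / e + r / e := by ring
        rw [h5]
        constructor <;> linarith
      have hfar : ∀ s : X, 3 * r < e * minDist A s → 2 * r / e < dist a s ∧ 2 * r / e < dist p s := by
        intro s hs
        have h3 : 3 * r / e < minDist A s := by rw [div_lt_iff₀ he]; linarith
        have h4 := minDist_le A s (σ p)
        rw [← ha, dist_comm] at h4
        have h5 := dist_triangle a p s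
        rw [dist_comm a p] at h5
        have h6 : 3 * r / e = 2 * r / e + r / e := by ring
        constructor <;> linarith [div_nonneg hr0 he.le]
      have c1 := abs_minDist_sub_le_of_close (hM S h1).1 (hM S' h2).1 fun l =>
        (h l).imp id fun hh => ⟨(hfar _ hh.1).1, (hfar _ hh.2).1⟩
      have c2 := abs_minDist_sub_le_of_close (hM S h1).2 (hM S' h2).2 fun l =>
        (h l).imp id fun hh => ⟨(hfar _ hh.1).2, (hfar _ hh.2).2⟩
      have d1 := abs_sq_sub_sq_le (minDist_nonneg S a) (minDist_nonneg S' a) (hM S h1).1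
        (hM S' h2).1 c1
      have d2 := abs_sq_sub_sq_le (minDist_nonneg S p) (minDist_nonneg S' p) (hM S h1).2
        (hM S' h2).2 c2
      have e1 : 2 * (2 * r / e) * (e ^ 2 * r) = 4 * e * r ^ 2 := by field_simp; ring
      rw [e1] at d1 d2
      rw [pointCost_eq, pointCost_eq, ← ha]
      have h7 : 0 ≤ 3 * e * (minDist S a ^ 2 + minDist S' a ^ 2) := by positivity
      rw [abs_le] at d1 d2 ⊢
      constructor <;> linarith [d1.1, d1.2, d2.1, d2.2]
    · have h3 : residual e A σ S' p = 0 := if_neg h2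
      rw [h3, sub_zero]
      have := abs_residual_le_of_not (S := S) he he1 (not_le.1 h2)
      have : 0 ≤ 8 * e * r ^ 2 := by positivity
      linarith
  · have h3 : residual e A σ S p = 0 := if_neg h1
    rw [h3, zero_sub, abs_neg]
    have h4 := abs_residual_le_of_not (S := S') he he1 (not_le.1 h1)
    rw [add_comm (minDist S' _ ^ 2)] at h4
    have : 0 ≤ 8 * e * r ^ 2 := by positivity
    linarith

end Residual

/-! ### Replacing a tuple by its representative -/

theorem sum_eq_sum_cluster {X : Type*} {k : ℕ} (P : Finset X) (σ : X → Fin k) (φ : Fin k → ℝ) :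
    ∑ p ∈ P, φ (σ p) = ∑ j, φ j * (cluster P σ j).card := by
  rw [← Finset.sum_fiberwise P σ]
  refine Finset.sum_congr rfl fun j _ => ?_
  rw [Finset.sum_congr rfl fun p hp => by rw [(Finset.mem_filter.1 hp).2], Finset.sum_const,
    nsmul_eq_mul, mul_comm]
  rfl

theorem sum_comp_cluster_eq {k : ℕ} {ι : Type*} [Fintype ι] (w : ι → ℝ) (τ : ι → Fin k)
    (φ : Fin k → ℝ) : ∑ i, w i * φ (τ i) = ∑ j, φ j * ∑ i, w i * (if τ i = j then 1 else 0) := by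
  simp only [Finset.mul_sum]
  rw [Finset.sum_comm]
  refine Finset.sum_congr rfl fun i _ => ?_
  simp [mul_comm]

theorem cluster_card_pos {X : Type*} {k : ℕ} {P : Finset X} {σ : X → Fin k} {p : X} (hp : p ∈ P) : (0 : ℝ) < (cluster P σ (σ p)).card := by
  exact Nat.cast_pos.2 (Finset.card_pos.2 ⟨p, Finset.mem_filter.2 ⟨hp, rfl⟩⟩)

section Transfer
variable {X : Type*} [MetricSpace X] {k : ℕ} [NeZero k] {e γ : ℝ} {P : Finset X} {A : Fin k → X}
  {σ : X → Fin k}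

theorem cost_eq_sum_sq (hσ : IsNearestAssignment P A σ) :
    cost P A = ∑ p ∈ P, dist p (A (σ p)) ^ 2 :=
  Finset.sum_congr rfl fun _ hp => pointCost_of_isNearest hσ hp

/-- The cost of moving the points to their centers in `A` and then to `S`. -/
theorem sum_minDist_center_le (hσ : IsNearestAssignment P A σ) (hγ : 1 ≤ γ)
    (hA : IsApproxSolution γ P A) (S : Fin k → X) :
    ∑ p ∈ P, minDist S (A (σ p)) ^ 2 ≤ 4 * γ * cost P S := by
  have h1 : ∑ p ∈ P, minDist S (A (σ p)) ^ 2
      ≤ ∑ p ∈ P, (2 * pointCost S p + 2 * dist p (A (σ p)) ^ 2) := by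
    refine Finset.sum_le_sum fun p _ => ?_
    have h2 := minDist_le_add S (A (σ p)) p
    rw [dist_comm] at h2
    have h3 := minDist_nonneg S (A (σ p))
    have h4 := pow_le_pow_left₀ h3 h2 2
    rw [pointCost_eq]
    nlinarith [sq_nonneg (minDist S p - dist p (A (σ p)))]
  rw [Finset.sum_add_distrib, ← Finset.mul_sum, ← Finset.mul_sum, ← cost_eq_sum_sq hσ] at h1
  have h5 := hA S
  have h6 : cost P S ≤ γ * cost P S := le_mul_of_one_le_left (cost_nonneg P S) hγ
  unfold cost at *
  linarith

/-- For weighted points whose cluster weights, total cost and exceptional costs are at most twice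
those of `P`, the residual for `S` can be replaced by the one for `S'` at small cost. -/
theorem sum_sub_residual_le {Θ : Type*} {θ : X → Θ} {E : Θ → Finset X}
    (hγ : 1 ≤ γ) (he : 0 < e) (he1 : e < 1)
    (hA : IsApproxSolution γ P A) (hσ : IsNearestAssignment P A σ)
    (hE : ∀ s s', θ s = θ s' → ∀ p ∈ P, p ∉ E (θ s) →
        dist s s' ≤ e ^ 2 * dist p (A (σ p)) ∨
          (3 * dist p (A (σ p)) < e * minDist A s ∧ 3 * dist p (A (σ p)) < e * minDist A s'))
    {ι : Type*} [Fintype ι] (w : ι → ℝ) (y : ι → X) (hw : ∀ i, 0 ≤ w i) (hy : ∀ i, y i ∈ P)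
    (h1 : ∀ j, ∑ i, w i * (if σ (y i) = j then 1 else 0) ≤ 2 * (cluster P σ j).card)
    (h2 : ∑ i, w i * dist (y i) (A (σ (y i))) ^ 2 ≤ 2 * cost P A)
    (h3 : ∀ a, ∑ i, w i * ((E a : Set X).indicator (fun p => dist p (A (σ p)) ^ 2) (y i))
        ≤ 2 * (e ^ 2 / k * cost P A))
    {S S' : Fin k → X} (hSS : ∀ l, θ (S l) = θ (S' l)) (hcost : cost P S' ≤ 2 * cost P S) :
    |∑ i, w i * (pointCost S (y i) - minDist S (A (σ (y i))) ^ 2 - residual e A σ S' (y i))|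
      ≤ 124 * γ * e * cost P S := by
  have hk : (0 : ℝ) < k := by exact_mod_cast Nat.pos_of_ne_zero (NeZero.ne k)
  have hpt : ∀ p ∈ P, |pointCost S p - minDist S (A (σ p)) ^ 2 - residual e A σ S' p|
      ≤ 6 * e * minDist S (A (σ p)) ^ 2 + 3 * e * minDist S' (A (σ p)) ^ 2
        + 8 * e * dist p (A (σ p)) ^ 2
        + ∑ l, 6 / e * ((E (θ (S l)) : Set X).indicator (fun p => dist p (A (σ p)) ^ 2) p) := by
    intro p hp
    have hn : ∀ l, 0 ≤ 6 / e *
        ((E (θ (S l)) : Set X).indicator (fun p => dist p (A (σ p)) ^ 2) p) := fun l =>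
      mul_nonneg (by positivity) (Set.indicator_apply_nonneg fun _ => sq_nonneg _)
    have b1 := abs_pointCost_sub_residual_le (A := A) (σ := σ) he he1 S p
    have b2 : |pointCost S p - minDist S (A (σ p)) ^ 2 - residual e A σ S' p|
        ≤ |pointCost S p - minDist S (A (σ p)) ^ 2 - residual e A σ S p|
          + |residual e A σ S p - residual e A σ S' p| := abs_sub_le _ _ _
    -- On an exceptional point both residuals are bounded separately by (3/e)r².
    by_cases hex : ∃ l, p ∈ E (θ (S l))
    · obtain ⟨l, hl⟩ := hex
      have b3 := Finset.single_le_sum (fun l _ => hn l) (Finset.mem_univ l)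
      rw [Set.indicator_of_mem (by exact_mod_cast hl)] at b3
      have b4 := abs_residual_le_div (A := A) (σ := σ) he he1 S p
      have b5 := abs_residual_le_div (A := A) (σ := σ) he he1 S' p
      have b6 := abs_sub (residual e A σ S p) (residual e A σ S' p)
      have b7 : 6 / e * dist p (A (σ p)) ^ 2
          = 3 / e * dist p (A (σ p)) ^ 2 + 3 / e * dist p (A (σ p)) ^ 2 := by ring
      have b8 : 0 ≤ 3 * e * minDist S (A (σ p)) ^ 2 := by positivity
      have b9 : 0 ≤ 3 * e * minDist S' (A (σ p)) ^ 2 := by positivity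
      have b10 : 0 ≤ 8 * e * dist p (A (σ p)) ^ 2 := by positivity
      linarith
    · push Not at hex
      have b3 := abs_residual_sub_le (A := A) (σ := σ) (S := S) (S' := S') (p := p) he he1
        fun l => hE _ _ (hSS l) p hp (hex l)
      have b4 := Finset.sum_nonneg fun l (_ : l ∈ Finset.univ) => hn l
      linarith
  have hcen : ∀ T : Fin k → X, ∑ i, w i * minDist T (A (σ (y i))) ^ 2 ≤ 8 * γ * cost P T := by
    intro T
    rw [sum_comp_cluster_eq w (fun i => σ (y i)) fun j => minDist T (A j) ^ 2]
    have c1 := sum_minDist_center_le hσ hγ hA T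
    rw [sum_eq_sum_cluster P σ fun j => minDist T (A j) ^ 2] at c1
    have c2 : ∑ j, minDist T (A j) ^ 2 * ∑ i, w i * (if σ (y i) = j then 1 else 0)
        ≤ ∑ j, 2 * (minDist T (A j) ^ 2 * (cluster P σ j).card) := by
      refine Finset.sum_le_sum fun j _ => ?_
      have := mul_le_mul_of_nonneg_left (h1 j) (sq_nonneg (minDist T (A j)))
      linarith
    rw [← Finset.mul_sum] at c2
    linarith
  refine (Finset.abs_sum_le_sum_abs _ _).trans ?_
  have d1 : ∑ i, |w i * (pointCost S (y i) - minDist S (A (σ (y i))) ^ 2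
      - residual e A σ S' (y i))|
      ≤ ∑ i, (6 * e * (w i * minDist S (A (σ (y i))) ^ 2)
        + 3 * e * (w i * minDist S' (A (σ (y i))) ^ 2)
        + 8 * e * (w i * dist (y i) (A (σ (y i))) ^ 2)
        + ∑ l, 6 / e * (w i *
          ((E (θ (S l)) : Set X).indicator (fun p => dist p (A (σ p)) ^ 2) (y i)))) := by
    refine Finset.sum_le_sum fun i _ => ?_
    rw [abs_mul, abs_of_nonneg (hw i)]
    refine (mul_le_mul_of_nonneg_left (hpt _ (hy i)) (hw i)).trans (le_of_eq ?_)
    rw [mul_add, Finset.mul_sum]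
    congr 1
    · ring
    · exact Finset.sum_congr rfl fun l _ => by ring
  refine d1.trans ?_
  rw [Finset.sum_add_distrib, Finset.sum_add_distrib, Finset.sum_add_distrib, Finset.sum_comm]
  simp only [← Finset.mul_sum]
  have d2 : 6 / e * ∑ l, ∑ i, (w i *
      ((E (θ (S l)) : Set X).indicator (fun p => dist p (A (σ p)) ^ 2) (y i)))
      ≤ 12 * e * cost P A := by
    have d3 := Finset.sum_le_sum fun l (_ : l ∈ Finset.univ) => h3 (θ (S l))
    rw [Finset.sum_const, Finset.card_univ, Fintype.card_fin, nsmul_eq_mul] at d3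
    refine (mul_le_mul_of_nonneg_left d3 (by positivity)).trans (le_of_eq ?_)
    field_simp
    ring
  have d4 := mul_le_mul_of_nonneg_left (hcen S) (by positivity : 0 ≤ 6 * e)
  have d5 := mul_le_mul_of_nonneg_left (hcen S') (by positivity : 0 ≤ 3 * e)
  have d6 := mul_le_mul_of_nonneg_left h2 (by positivity : 0 ≤ 8 * e)
  have d7 := mul_le_mul_of_nonneg_left (hA S) (by positivity : 0 ≤ 28 * e)
  have d8 := mul_le_mul_of_nonneg_left hcost (by positivity : 0 ≤ 24 * γ * e)
  -- The constant is 48 from S, 48 from S' (using cost(P,S') ≤ 2·cost(P,S)), and 16 + 12 from the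
  -- cost for A.
  linarith

end Transfer

/-! ### Lower bounds for the sampling distribution -/

section Prob
variable {X : Type*} [MetricSpace X] {k : ℕ} [NeZero k] {P : Finset X} {A : Fin k → X}
  {σ : X → Fin k}

theorem score_terms_nonneg (P : Finset X) (A : Fin k → X) (σ : X → Fin k) (p : X) :
    0 ≤ 1 / ((k : ℝ) * ((cluster P σ (σ p)).card : ℝ)) ∧
    0 ≤ pointCost A p / ((k : ℝ) * cost (cluster P σ (σ p)) A) ∧
    0 ≤ pointCost A p / cost P A ∧ 0 ≤ avgCost P A σ p / cost P A := by
  have h1 := pointCost_nonneg A p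
  have h2 := cost_nonneg P A
  have h3 := cost_nonneg (cluster P σ (σ p)) A
  unfold avgCost
  refine ⟨?_, ?_, ?_, ?_⟩ <;> positivity

theorem score_pos {p : X} (hp : p ∈ P) : 0 < score P A σ p := by
  have hk : (0 : ℝ) < k := by exact_mod_cast Nat.pos_of_ne_zero (NeZero.ne k)
  obtain ⟨-, h2, h3, h4⟩ := score_terms_nonneg P A σ p
  have h1 : 0 < 1 / ((k : ℝ) * ((cluster P σ (σ p)).card : ℝ)) :=
    one_div_pos.2 (mul_pos hk (cluster_card_pos hp))
  unfold score
  linarith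

/-- Each of the four terms sums to at most 1 over P; reading 0/0 as 0 can only lose mass. Hence
rescaling never decreases a score. -/
theorem sum_score_le_one (P : Finset X) (A : Fin k → X) (σ : X → Fin k) :
    ∑ p ∈ P, score P A σ p ≤ 1 := by
  have hk : (0 : ℝ) < k := by exact_mod_cast Nat.pos_of_ne_zero (NeZero.ne k)
  have key : ∀ j, ∑ p ∈ cluster P σ j, score P A σ p
      ≤ 1 / 4 * (2 / k + 2 * (cost (cluster P σ j) A / cost P A)) := by
    intro j
    have e : ∀ p ∈ cluster P σ j, score P A σ p
        = 1 / 4 * (1 / ((k : ℝ) * ((cluster P σ j).card : ℝ))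
          + pointCost A p / ((k : ℝ) * cost (cluster P σ j) A) + pointCost A p / cost P A
          + cost (cluster P σ j) A / ((cluster P σ j).card : ℝ) / cost P A) := by
      intro p hp
      have hp' : σ p = j := (Finset.mem_filter.mp hp).2
      simp only [score, avgCost, hp']
    rw [Finset.sum_congr rfl e, ← Finset.mul_sum, Finset.sum_add_distrib, Finset.sum_add_distrib,
      Finset.sum_add_distrib, ← Finset.sum_div _ (pointCost A),
      ← Finset.sum_div _ (pointCost A), Finset.sum_const, Finset.sum_const, nsmul_eq_mul, nsmul_eq_mul]
    have e2 : ∑ p ∈ cluster P σ j, pointCost A p = cost (cluster P σ j) A := rfl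
    simp only [e2]
    have hk' : (0 : ℝ) ≤ 1 / k := by positivity
    have hn : (0 : ℝ) ≤ (cluster P σ j).card := Nat.cast_nonneg _
    have hc := cost_nonneg (cluster P σ j) A
    have hcP := cost_nonneg P A
    have t1 : ((cluster P σ j).card : ℝ) * (1 / ((k : ℝ) * ((cluster P σ j).card : ℝ)))
        ≤ 1 / k := by
      have : ((cluster P σ j).card : ℝ) * (1 / ((k : ℝ) * ((cluster P σ j).card : ℝ)))
        = 1 / k * ((cluster P σ j).card / (cluster P σ j).card) := by
          rw [mul_one_div, mul_comm (k : ℝ), ← div_div, one_div_mul_eq_div]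
      rw [this]
      exact mul_le_of_le_one_right hk' (div_self_le_one _)
    have t2 : cost (cluster P σ j) A / ((k : ℝ) * cost (cluster P σ j) A) ≤ 1 / k := by
      have : cost (cluster P σ j) A / ((k : ℝ) * cost (cluster P σ j) A)
        = 1 / k * (cost (cluster P σ j) A / cost (cluster P σ j) A) := by
          rw [mul_comm (k : ℝ), ← div_div, one_div_mul_eq_div]
      rw [this]
      exact mul_le_of_le_one_right hk' (div_self_le_one _)
    have t3 : ((cluster P σ j).card : ℝ)
        * (cost (cluster P σ j) A / ((cluster P σ j).card : ℝ) / cost P A)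
        ≤ cost (cluster P σ j) A / cost P A := by
      have : ((cluster P σ j).card : ℝ)
        * (cost (cluster P σ j) A / ((cluster P σ j).card : ℝ) / cost P A)
        = cost (cluster P σ j) A / cost P A
          * (((cluster P σ j).card : ℝ) / (cluster P σ j).card) := by ring
      rw [this]
      exact mul_le_of_le_one_right (by positivity) (div_self_le_one _)
    have t4 : (2 : ℝ) / k = 1 / k + 1 / k := by ring
    linarith
  have htot : ∑ j, cost (cluster P σ j) A = cost P A := Finset.sum_fiberwise P σ _
  rw [← Finset.sum_fiberwise P σ]
  refine (Finset.sum_le_sum fun j _ => key j).trans ?_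
  rw [← Finset.mul_sum, Finset.sum_add_distrib, ← Finset.mul_sum,
    ← Finset.sum_div _ (fun j => cost (cluster P σ j) A), htot,
    Finset.sum_const, Finset.card_univ, Fintype.card_fin, nsmul_eq_mul, mul_div_cancel₀ _ hk.ne']
  have := div_self_le_one (cost P A)
  linarith

theorem score_le_samplingProb {p : X} (hp : p ∈ P) : score P A σ p ≤ samplingProb P A σ p := by
  have h1 : 0 < ∑ x ∈ P, score P A σ x := Finset.sum_pos (fun x hx => score_pos hx) ⟨p, hp⟩
  rw [samplingProb, le_div_iff₀ h1]
  exact mul_le_of_le_one_right (score_pos hp).le (sum_score_le_one P A σ)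

theorem samplingProb_pos {p : X} (hp : p ∈ P) : 0 < samplingProb P A σ p :=
  (score_pos hp).trans_le (score_le_samplingProb hp)

theorem sum_samplingProb (hP : P.Nonempty) : ∑ p : P, samplingProb P A σ p = 1 := by
  have h1 : 0 < ∑ x ∈ P, score P A σ x := Finset.sum_pos (fun x hx => score_pos hx) hP
  rw [Finset.sum_coe_sort P fun p => samplingProb P A σ p]
  unfold samplingProb
  rw [← Finset.sum_div, div_self h1.ne']

theorem one_le_card_mul_samplingProb {p : X} (hp : p ∈ P) :
    1 ≤ 4 * k * (cluster P σ (σ p)).card * samplingProb P A σ p := by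
  have hk : (0 : ℝ) < k := by exact_mod_cast Nat.pos_of_ne_zero (NeZero.ne k)
  have hn := cluster_card_pos (σ := σ) hp
  obtain ⟨-, h2, h3, h4⟩ := score_terms_nonneg P A σ p
  have h5 := score_le_samplingProb (A := A) (σ := σ) hp
  have h6 : 1 / ((k : ℝ) * ((cluster P σ (σ p)).card : ℝ)) ≤ 4 * samplingProb P A σ p := by
    unfold score at h5; linarith
  rw [div_le_iff₀ (by positivity)] at h6
  linarith

theorem pointCost_le_mul_samplingProb {p : X} (hp : p ∈ P) :
    pointCost A p ≤ 4 * cost P A * samplingProb P A σ p := by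
  obtain ⟨h1, h2, -, h4⟩ := score_terms_nonneg P A σ p
  have h5 := score_le_samplingProb (A := A) (σ := σ) hp
  have h6 : pointCost A p / cost P A ≤ 4 * samplingProb P A σ p := by
    unfold score at h5; linarith
  rcases (cost_nonneg P A).eq_or_lt with h | h
  · have : pointCost A p ≤ cost P A :=
      Finset.single_le_sum (f := fun p => pointCost A p) (fun q _ => pointCost_nonneg A q) hp
    rw [← h] at this ⊢
    linarith
  · rw [div_le_iff₀ h] at h6
    linarith

end Prob

theorem sum_indicator_cluster {X : Type*} {k : ℕ} (P : Finset X) (σ : X → Fin k) (j : Fin k) :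
    ∑ p : P, (if σ p = j then (1 : ℝ) else 0) = (cluster P σ j).card := by
  rw [Finset.sum_coe_sort P fun p => if σ p = j then (1 : ℝ) else 0, Finset.sum_boole]
  rfl

theorem sum_indicator_subset {X : Type*} {P E : Finset X} (hE : E ⊆ P) (f : X → ℝ) :
    ∑ p : P, (E : Set X).indicator f p = ∑ p ∈ E, f p := by
  classical
  rw [Finset.sum_coe_sort P fun p => (E : Set X).indicator f p]
  exact Finset.sum_indicator_subset f hE

/-! ### Deterministic criterion for a coreset -/

section Coreset
variable {X : Type*} [MetricSpace X] {k : ℕ} [NeZero k] {e γ : ℝ} {P : Finset X} {A : Fin k → X}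
  {σ : X → Fin k}

/-- Weighted points form a coreset if they estimate the cluster sizes, the cost for `A`, the costs
of the exceptional sets and sufficiently many residuals. -/
theorem isCoreset_of_estimates {Θ : Type*} {θ : X → Θ} {E : Θ → Finset X}
    (hγ : 1 ≤ γ) (he : 0 < e) (he1 : e < 1)
    (hA : IsApproxSolution γ P A) (hσ : IsNearestAssignment P A σ)
    (hEP : ∀ a, E a ⊆ P)
    (hEm : ∀ a, ∑ p ∈ E a, dist p (A (σ p)) ^ 2 ≤ e ^ 2 / k * cost P A)
    (hE : ∀ s s', θ s = θ s' → ∀ p ∈ P, p ∉ E (θ s) →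
        dist s s' ≤ e ^ 2 * dist p (A (σ p)) ∨
          (3 * dist p (A (σ p)) < e * minDist A s ∧ 3 * dist p (A (σ p)) < e * minDist A s'))
    {m : ℕ} (w : Fin m → ℝ) (y : Fin m → X) (hw : ∀ i, 0 ≤ w i) (hy : ∀ i, y i ∈ P)
    (h1 : ∀ j, |∑ i, w i * (if σ (y i) = j then 1 else 0) - (cluster P σ j).card|
      ≤ e * (cluster P σ j).card)
    (h2 : |∑ i, w i * dist (y i) (A (σ (y i))) ^ 2 - cost P A| ≤ cost P A)
    (h3 : ∀ a, |∑ i, w i * ((E a : Set X).indicator (fun p => dist p (A (σ p)) ^ 2) (y i))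
        - ∑ p ∈ E a, dist p (A (σ p)) ^ 2| ≤ e ^ 2 / k * cost P A)
    (h4 : ∀ S, ∃ S', (∀ l, θ (S l) = θ (S' l)) ∧ cost P S' ≤ 2 * cost P S ∧
      |∑ i, w i * residual e A σ S' (y i) - ∑ p ∈ P, residual e A σ S' p| ≤ e * cost P S') :
    IsCoreset k (256 * γ * e) P y w := by
  intro S
  obtain ⟨S', hSS, hcost, hres⟩ := h4 S
  have hc := cost_nonneg P S
  have hcA := cost_nonneg P A
  -- The replacement bound is used twice: for the weighted sample, and in `b2` for P with unit
  -- weights. With 4 from the cluster sizes and 2 from the residual estimate, the total is 124 + 124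
  -- + 4 + 2 ≤ 256.
  have b1 := sum_sub_residual_le hγ he he1 hA hσ hE w y hw hy
    (fun j => by
      have c1 := (abs_le.1 (h1 j)).2
      have c2 : e * ((cluster P σ j).card : ℝ) ≤ 1 * (cluster P σ j).card :=
        mul_le_mul_of_nonneg_right he1.le (Nat.cast_nonneg _)
      linarith)
    (by have := (abs_le.1 h2).2; linarith)
    (fun a => by have := (abs_le.1 (h3 a)).2; have := hEm a; linarith) hSS hcost
  have b2 := sum_sub_residual_le hγ he he1 hA hσ hE (fun _ : P => (1 : ℝ)) (fun p => (p : X))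
    (fun _ => zero_le_one) (fun p => p.2)
    (fun j => by
      simp only [one_mul]
      rw [sum_indicator_cluster]
      have : (0 : ℝ) ≤ (cluster P σ j).card := Nat.cast_nonneg _
      linarith)
    (by
      simp only [one_mul]
      rw [Finset.sum_coe_sort P fun p => dist p (A (σ p)) ^ 2, ← cost_eq_sum_sq hσ]
      linarith)
    (fun a => by
      simp only [one_mul]
      rw [sum_indicator_subset (hEP a)]
      have : 0 ≤ e ^ 2 / k * cost P A := by positivity
      linarith [hEm a]) hSS hcost
  simp only [one_mul] at b2
  rw [Finset.sum_coe_sort P fun p => pointCost S p - minDist S (A (σ p)) ^ 2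
    - residual e A σ S' p] at b2
  have b3 : |∑ i, w i * minDist S (A (σ (y i))) ^ 2 - ∑ p ∈ P, minDist S (A (σ p)) ^ 2|
      ≤ e * (4 * γ * cost P S) := by
    have c1 := sum_minDist_center_le hσ hγ hA S
    rw [sum_eq_sum_cluster P σ fun j => minDist S (A j) ^ 2] at c1 ⊢
    rw [sum_comp_cluster_eq w (fun i => σ (y i)) fun j => minDist S (A j) ^ 2,
      ← Finset.sum_sub_distrib]
    refine (Finset.abs_sum_le_sum_abs _ _).trans ?_
    refine le_trans ?_ (mul_le_mul_of_nonneg_left c1 he.le)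
    rw [Finset.mul_sum]
    refine Finset.sum_le_sum fun j _ => ?_
    rw [← mul_sub, abs_mul, abs_of_nonneg (sq_nonneg _)]
    have := mul_le_mul_of_nonneg_left (h1 j) (sq_nonneg (minDist S (A j)))
    linarith
  have b4 := mul_le_mul_of_nonneg_left hcost he.le
  have b5 : e * cost P S ≤ γ * e * cost P S := by
    have : 0 ≤ e * cost P S := by positivity
    nlinarith
  simp only [mul_sub, Finset.sum_sub_distrib] at b1 b2
  rw [show ∑ p ∈ P, pointCost S p = cost P S from rfl] at b2
  have b6 : 0 ≤ γ * e * cost P S := by positivity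
  rw [abs_le] at b1 b2 b3 hres ⊢
  constructor <;> linarith [b1.1, b1.2, b2.1, b2.2, b3.1, b3.2, hres.1, hres.2]

end Coreset

/-! ### Concentration of the estimates -/

section Concentration
variable {X : Type*} [MetricSpace X] {k : ℕ} [NeZero k] {e γ : ℝ} {P : Finset X} {A : Fin k → X}
  {σ : X → Fin k} {m : ℕ}

/-- The score term 1/(k|C_j|) keeps each sampled contribution below 4k|C_j|, so a relative error e
costs a factor k in the exponent. -/
theorem cluster_size_tail (hP : P.Nonempty) (he : 0 < e) (he1 : e < 1) (j : Fin k) :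
    productProb (fun p : P => samplingProb P A σ p) m {q | e * (cluster P σ j).card <
      |∑ i, sampleWeight P A σ m (q i) * (if σ (q i) = j then 1 else 0)
        - (cluster P σ j).card|} ≤ 2 * Real.exp (-(m * (e ^ 2 / (16 * k)))) := by
  have hk : (0 : ℝ) < k := by exact_mod_cast Nat.pos_of_ne_zero (NeZero.ne k)
  have hμ : ∀ p : P, 0 < samplingProb P A σ p := fun p => samplingProb_pos p.2
  rcases Nat.eq_zero_or_pos (cluster P σ j).card with h0 | hn
  · have hne : ∀ p : P, σ p ≠ j := by
      intro p hp
      have : (p : X) ∈ cluster P σ j := Finset.mem_filter.2 ⟨p.2, hp⟩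
      rw [Finset.card_eq_zero.1 h0] at this
      simp at this
    have : {q : Fin m → P | e * (cluster P σ j).card <
      |∑ i, sampleWeight P A σ m (q i) * (if σ (q i) = j then 1 else 0)
        - (cluster P σ j).card|} = ∅ := by
      ext q
      simp [h0, hne]
    rw [this]
    simp only [productProb, Set.indicator_empty, Finset.sum_const_zero]
    positivity
  · have hn' : (0 : ℝ) < (cluster P σ j).card := by exact_mod_cast hn
    set N : ℝ := ((cluster P σ j).card : ℝ) with hN
    have hb : ∀ p : P, (if σ p = j then (1 : ℝ) else 0) ≤ 4 * k * N * samplingProb P A σ p := by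
      intro p
      split_ifs with h
      · have := one_le_card_mul_samplingProb (A := A) (σ := σ) p.2
        rwa [h] at this
      · have := hμ p; positivity
    have key := productProb_abs_tail (m := m) hμ (sum_samplingProb hP)
      (fun p : P => if σ p = j then (1 : ℝ) else 0) (l := e / (8 * k * N)) (t := e * N)
      (V := 4 * k * N ^ 2) (by positivity) ?_ ?_ ?_
    · rw [sum_indicator_cluster] at key
      refine key.trans (le_of_eq ?_)
      congr 3
      field_simp
      ring
    · intro p
      have h1 := hb p
      have h2 : 0 ≤ (if σ p = j then (1 : ℝ) else 0) := by split_ifs <;> norm_num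
      rw [abs_of_nonneg (by positivity), div_mul_eq_mul_div, div_le_iff₀ (by positivity)]
      have := hμ p
      have h3 : 0 ≤ 4 * k * N * samplingProb P A σ p := by positivity
      nlinarith
    · have h3 : ∀ p : P, (if σ p = j then (1 : ℝ) else 0) ^ 2 / samplingProb P A σ p
          ≤ 4 * k * N * (if σ p = j then (1 : ℝ) else 0) := by
        intro p
        rw [div_le_iff₀ (hμ p)]
        have h1 := hb p
        split_ifs at h1 ⊢ <;> linarith
      refine (Finset.sum_le_sum fun p _ => h3 p).trans ?_
      rw [← Finset.mul_sum, sum_indicator_cluster]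
      exact le_of_eq (by ring)
    · refine le_of_eq ?_
      field_simp
      ring

/-- Concentration for the cost of a part of `P`. -/
theorem sub_cost_tail (hP : P.Nonempty) (hσ : IsNearestAssignment P A σ) (hcA : 0 < cost P A)
    {E : Finset X} (hEP : E ⊆ P) {b : ℝ}
    (hE : ∑ p ∈ E, dist p (A (σ p)) ^ 2 ≤ b * cost P A) :
    productProb (fun p : P => samplingProb P A σ p) m {q | b * cost P A <
      |∑ i, sampleWeight P A σ m (q i)
          * ((E : Set X).indicator (fun p => dist p (A (σ p)) ^ 2) (q i))
        - ∑ p ∈ E, dist p (A (σ p)) ^ 2|} ≤ 2 * Real.exp (-(m * (b / 16))) := by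
  have hμ : ∀ p : P, 0 < samplingProb P A σ p := fun p => samplingProb_pos p.2
  set f : X → ℝ := (E : Set X).indicator (fun p => dist p (A (σ p)) ^ 2) with hf
  have hf0 : ∀ p, 0 ≤ f p := fun p => Set.indicator_apply_nonneg fun _ => sq_nonneg _
  have hfb : ∀ p : P, f p ≤ 4 * cost P A * samplingProb P A σ p := by
    intro p
    have h1 := pointCost_le_mul_samplingProb (A := A) (σ := σ) p.2
    rw [pointCost_of_isNearest hσ p.2] at h1
    exact (Set.indicator_le_self' (fun _ _ => sq_nonneg _) _).trans h1
  have key := productProb_abs_tail (m := m) hμ (sum_samplingProb hP)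
    (fun p : P => f p) (l := 1 / (8 * cost P A)) (t := b * cost P A)
    (V := 4 * cost P A * (b * cost P A)) (by positivity) ?_ ?_ ?_
  · rw [sum_indicator_subset hEP] at key
    refine key.trans (le_of_eq ?_)
    congr 3
    field_simp
    ring
  · intro p
    have h1 := hfb p
    have h2 := hf0 p
    rw [abs_of_nonneg (by positivity), one_div_mul_eq_div, div_le_iff₀ (by positivity)]
    have := mul_pos hcA (hμ p)
    linarith
  · have h3 : ∀ p : P, f p ^ 2 / samplingProb P A σ p ≤ 4 * cost P A * f p := by
      intro p
      rw [div_le_iff₀ (hμ p)]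
      have := mul_le_mul_of_nonneg_left (hfb p) (hf0 p)
      linarith
    refine (Finset.sum_le_sum fun p _ => h3 p).trans ?_
    rw [← Finset.mul_sum, sum_indicator_subset hEP]
    exact mul_le_mul_of_nonneg_left hE (by positivity)
  · refine le_of_eq ?_
    field_simp
    ring

theorem residual_tail (hP : P.Nonempty) (hγ : 1 ≤ γ) (he : 0 < e) (he1 : e < 1)
    (hA : IsApproxSolution γ P A) (hσ : IsNearestAssignment P A σ) (hcA : 0 < cost P A)
    (S : Fin k → X) :
    productProb (fun p : P => samplingProb P A σ p) m {q | e * cost P S <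
      |∑ i, sampleWeight P A σ m (q i) * residual e A σ S (q i)
        - ∑ p ∈ P, residual e A σ S p|}
      ≤ 2 * Real.exp (-(m * (e ^ 2 / (544 * γ ^ 2)))) := by
  have hμ : ∀ p : P, 0 < samplingProb P A σ p := fun p => samplingProb_pos p.2
  have hγ0 : 0 < γ := by linarith
  have hAS := hA S
  have hB : 0 < cost P S := pos_of_mul_pos_right (hcA.trans_le hAS) hγ0.le
  set B := cost P S with hBdef
  have hr : ∀ p : P, dist (p : X) (A (σ p)) ^ 2 ≤ 4 * cost P A * samplingProb P A σ p := by
    intro p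
    have h1 := pointCost_le_mul_samplingProb (A := A) (σ := σ) p.2
    rwa [pointCost_of_isNearest hσ p.2] at h1
  have key := productProb_abs_tail (m := m) hμ (sum_samplingProb hP)
    (fun p : P => residual e A σ S p) (l := e / (272 * γ ^ 2 * B)) (t := e * B)
    (V := 136 * γ ^ 2 * B ^ 2) (by positivity) ?_ ?_ ?_
  · rw [Finset.sum_coe_sort P fun p => residual e A σ S p] at key
    refine key.trans (le_of_eq ?_)
    congr 3
    field_simp
    ring
  · intro p
    have h1 := abs_residual_le_div (A := A) (σ := σ) he he1 S p
    have hμp := hμ p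
    rw [abs_mul, abs_of_pos (by positivity), div_mul_eq_mul_div, div_le_iff₀ (by positivity)]
    have h2 : e * |residual e A σ S p| ≤ 3 * dist (p : X) (A (σ p)) ^ 2 := by
      have := mul_le_mul_of_nonneg_left h1 he.le
      refine this.trans (le_of_eq ?_)
      field_simp
    have h3 : cost P A * samplingProb P A σ p ≤ γ ^ 2 * B * samplingProb P A σ p := by
      refine mul_le_mul_of_nonneg_right (hAS.trans ?_) hμp.le
      refine mul_le_mul_of_nonneg_right ?_ hB.le
      nlinarith
    have h4 : 0 ≤ γ ^ 2 * B * samplingProb P A σ p := by positivity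
    linarith [hr p]
  · have h3 : ∀ p : P, residual e A σ S p ^ 2 / samplingProb P A σ p
        ≤ 4 * cost P A * (8 * minDist S (A (σ p)) ^ 2 + 2 * dist (p : X) (A (σ p)) ^ 2) := by
      intro p
      rw [div_le_iff₀ (hμ p)]
      have h1 := abs_residual_le (e := e) (A := A) (σ := σ) S p
      have h2 := pow_le_pow_left₀ (abs_nonneg _) h1 2
      rw [sq_abs] at h2
      set d := minDist S (A (σ p))
      set r := dist (p : X) (A (σ p))
      -- The factor r² pays for 1/μ(p); the other factor sums over P to at most 34γ·cost(P,S),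
      -- whence 136 = 4·34.
      have h4 : (2 * d * r + r ^ 2) ^ 2 ≤ (8 * d ^ 2 + 2 * r ^ 2) * r ^ 2 := by
        have : (8 * d ^ 2 + 2 * r ^ 2) * r ^ 2 - (2 * d * r + r ^ 2) ^ 2
          = ((2 * d - r) * r) ^ 2 := by ring
        nlinarith [sq_nonneg ((2 * d - r) * r)]
      have h5 := mul_le_mul_of_nonneg_left (hr p) (by positivity : 0 ≤ 8 * d ^ 2 + 2 * r ^ 2)
      linarith
    refine (Finset.sum_le_sum fun p _ => h3 p).trans ?_
    rw [← Finset.mul_sum, Finset.sum_coe_sort P fun p =>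
      8 * minDist S (A (σ p)) ^ 2 + 2 * dist p (A (σ p)) ^ 2, Finset.sum_add_distrib,
      ← Finset.mul_sum, ← Finset.mul_sum, ← cost_eq_sum_sq hσ]
    have h4 := sum_minDist_center_le hσ hγ hA S
    have h5 : 8 * ∑ p ∈ P, minDist S (A (σ p)) ^ 2 + 2 * cost P A ≤ 34 * γ * B := by linarith
    refine (mul_le_mul_of_nonneg_left h5 (by positivity)).trans ?_
    have h6 : 0 ≤ 34 * γ * B := by positivity
    nlinarith [mul_le_mul_of_nonneg_right hAS h6]
  · refine le_of_eq ?_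
    field_simp
    ring

end Concentration

/-! ### Representatives and the union bound -/

/-- Every class of `k`-tuples of centers has a member of nearly minimal cost. -/
theorem exists_representatives {X : Type*} [MetricSpace X] {k : ℕ} {γ : ℝ} {P : Finset X}
    {A : Fin k → X} {Θ : Type*} (θ : X → Θ) (hγ : 1 ≤ γ)
    (hA : IsApproxSolution γ P A) (hcA : 0 < cost P A) :
    ∃ rep : (Fin k → Θ) → Fin k → X, ∀ S : Fin k → X,
      (∀ l, θ (S l) = θ (rep (fun l => θ (S l)) l)) ∧
        cost P (rep fun l => θ (S l)) ≤ 2 * cost P S := by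
  have hpos : ∀ S : Fin k → X, cost P A / γ ≤ cost P S := fun S => by
    rw [div_le_iff₀ (by linarith)]; linarith [hA S]
  have : ∀ a : Fin k → Θ, ∃ S' : Fin k → X, ∀ S : Fin k → X, (fun l => θ (S l)) = a →
      (fun l => θ (S' l)) = a ∧ cost P S' ≤ 2 * cost P S := by
    intro a
    by_cases hne : ∃ S : Fin k → X, (fun l => θ (S l)) = a
    · let K := (cost P) '' {S : Fin k → X | (fun l => θ (S l)) = a}
      have hK : K.Nonempty := by
        obtain ⟨S, hS⟩ := hne
        exact ⟨_, S, hS, rfl⟩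
      have hbdd : BddBelow K := ⟨cost P A / γ, by rintro _ ⟨S, -, rfl⟩; exact hpos S⟩
      -- The infimum need not be attained, but approximate optimality of A keeps it positive, so
      -- some member costs less than twice the infimum.
      have hinf : 0 < sInf K := (div_pos hcA (by linarith : 0 < γ)).trans_le
        (le_csInf hK (by rintro _ ⟨S, -, rfl⟩; exact hpos S))
      obtain ⟨_, ⟨S', hS', rfl⟩, hlt⟩ := exists_lt_of_csInf_lt hK
        (show sInf K < 2 * sInf K by linarith)
      refine ⟨S', fun S hS => ⟨hS', ?_⟩⟩
      have := csInf_le hbdd (Set.mem_image_of_mem (cost P) hS)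
      linarith
    · exact ⟨A, fun S hS => absurd ⟨S, hS⟩ hne⟩
  choose rep hrep using this
  exact ⟨rep, fun S => ⟨fun l => (congrFun (hrep _ S rfl).1 l).symm, (hrep _ S rfl).2⟩⟩

section Failure
variable {X : Type*} [MetricSpace X] {k : ℕ} [NeZero k] {e γ : ℝ} {P : Finset X} {A : Fin k → X}
  {σ : X → Fin k} {m : ℕ}

theorem sampleWeight_nonneg {p : X} (hp : p ∈ P) : 0 ≤ sampleWeight P A σ m p := by
  have := samplingProb_pos (A := A) (σ := σ) hp
  unfold sampleWeight
  positivity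

/-- An explicit bound for the failure probability of sensitivity sampling. -/
theorem sampleProbability_ge {D : ℕ} (hX : BallsCovered X D) (hP : P.Nonempty) (hγ : 1 ≤ γ)
    (he : 0 < e) (he1 : e < 1) (hA : IsApproxSolution γ P A) (hσ : IsNearestAssignment P A σ)
    {N n M : ℕ} (hN : k / e ^ 2 ≤ N) (hn : 6 / e ^ 3 ≤ 2 ^ n)
    (hM : M = k * ((N + 1) * 2 ^ (D * n))) :
    1 - (k * (2 * Real.exp (-(m * (e ^ 2 / (16 * k))))) + 2 * Real.exp (-(m * (1 / 16)))
        + M * (2 * Real.exp (-(m * (e ^ 2 / (16 * k)))))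
        + M ^ k * (2 * Real.exp (-(m * (e ^ 2 / (544 * γ ^ 2)))))) ≤
      sampleProbability P A σ m {q | IsCoreset k (256 * γ * e) P (fun i => (q i : X))
        (fun i => sampleWeight P A σ m (q i))} := by
  have hk : (0 : ℝ) < k := by exact_mod_cast Nat.pos_of_ne_zero (NeZero.ne k)
  have hμ : ∀ p : P, 0 ≤ samplingProb P A σ p := fun p => (samplingProb_pos p.2).le
  show _ ≤ productProb (fun p : P => samplingProb P A σ p) m _
  have hB1 := productProb_iUnion_le hμ _
    fun j : Fin k => cluster_size_tail (A := A) (σ := σ) (m := m) hP he he1 j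
  rw [Fintype.card_fin] at hB1
  set B1 := ⋃ j : Fin k, {q : Fin m → P | e * (cluster P σ j).card <
      |∑ i, sampleWeight P A σ m (q i) * (if σ (q i) = j then 1 else 0)
        - (cluster P σ j).card|} with hB1def
  have hgood1 : ∀ q, q ∉ B1 → ∀ j,
      |∑ i, sampleWeight P A σ m (q i) * (if σ (q i) = j then 1 else 0)
        - (cluster P σ j).card| ≤ e * (cluster P σ j).card := fun q hq j =>
    not_lt.1 fun h => hq (Set.mem_iUnion.2 ⟨j, h⟩)
  -- If cost(P,A) = 0, every point sits on its center and all residuals vanish: correct cluster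
  -- sizes suffice, with one trivial class and all of P exceptional.
  rcases (cost_nonneg P A).eq_or_lt with hcA | hcA
  · have hr : ∀ p ∈ P, dist p (A (σ p)) = 0 := by
      have h1 := cost_eq_sum_sq hσ
      rw [← hcA] at h1
      intro p hp
      have h2 := (Finset.sum_eq_zero_iff_of_nonneg fun p _ => sq_nonneg (dist p (A (σ p)))).1
        h1.symm p hp
      exact pow_eq_zero_iff two_ne_zero |>.1 h2
    have hres : ∀ S : Fin k → X, ∀ p ∈ P, residual e A σ S p = 0 := by
      intro S p hp
      have h1 := abs_residual_le (e := e) (A := A) (σ := σ) S p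
      rw [hr p hp] at h1
      norm_num at h1
      exact h1
    refine le_trans ?_ (one_sub_le_productProb hμ (sum_samplingProb hP) (B := B1) ?_)
    · have e1 : 0 ≤ 2 * Real.exp (-(m * (1 / 16 : ℝ))) := by positivity
      have e2 : 0 ≤ M * (2 * Real.exp (-(m * (e ^ 2 / (16 * k))))) := by positivity
      have e3 : 0 ≤ (M : ℝ) ^ k * (2 * Real.exp (-(m * (e ^ 2 / (544 * γ ^ 2))))) := by positivity
      linarith
    · intro q hq
      by_contra hqB
      refine hq (isCoreset_of_estimates (θ := fun _ => ()) (E := fun _ => P) hγ he he1 hA hσ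
        (fun _ => subset_rfl) (fun _ => ?_) (fun s s' _ p hp hpP => absurd hp hpP) _ _
        (fun i => sampleWeight_nonneg (q i).2) (fun i => (q i).2) (hgood1 q hqB) ?_ (fun _ => ?_)
        fun S => ⟨S, fun _ => rfl, by linarith [cost_nonneg P S], ?_⟩)
      · rw [← cost_eq_sum_sq hσ, ← hcA, mul_zero]
      · rw [← hcA, Finset.sum_eq_zero fun i _ => by rw [hr _ (q i).2]; ring]
        simp
      · rw [← cost_eq_sum_sq hσ, ← hcA, Finset.sum_eq_zero fun i _ => by
          rw [Set.indicator_of_mem (q i).2, hr _ (q i).2]; ring]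
        simp
      · rw [Finset.sum_eq_zero fun i _ => by rw [hres S _ (q i).2, mul_zero],
          Finset.sum_eq_zero fun p hp => hres S p hp, sub_zero, abs_zero]
        exact mul_nonneg he.le (cost_nonneg P S)
  · have hNpos : 0 < N := by
      have : (0 : ℝ) < N := lt_of_lt_of_le (by positivity) hN
      exact_mod_cast this
    have hsum := cost_eq_sum_sq hσ
    obtain ⟨θ, E, hEP, hEm, hE⟩ := exists_center_classes hX P A (fun p => dist p (A (σ p)))
      (fun _ => dist_nonneg) (by rw [← hsum]; exact hcA) he hNpos hn
    rw [← hsum] at hEm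
    replace hEm : ∀ a, ∑ p ∈ E a, dist p (A (σ p)) ^ 2 ≤ e ^ 2 / k * cost P A := by
      intro a
      refine (hEm a).trans ?_
      have hN' : (0 : ℝ) < N := by exact_mod_cast hNpos
      rw [div_le_iff₀ (by positivity)] at hN
      rw [div_le_iff₀ hN', div_mul_eq_mul_div, div_mul_eq_mul_div, le_div_iff₀ hk]
      nlinarith
    obtain ⟨rep, hrep⟩ := exists_representatives θ hγ hA hcA
    have hcard : Fintype.card (Fin k × Fin (N + 1) × Fin (2 ^ (D * n))) = M := by
      simp [hM]
    have hB2 := sub_cost_tail (m := m) hP hσ hcA (subset_refl P)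
      (b := 1) (by rw [one_mul, hsum])
    have hB3 := productProb_iUnion_le hμ _ fun a =>
      sub_cost_tail (m := m) hP hσ hcA (hEP a) (hEm a)
    have hB4 := productProb_iUnion_le hμ _ fun a =>
      residual_tail (m := m) hP hγ he he1 hA hσ hcA (rep a)
    rw [Fintype.card_fun, hcard, Fintype.card_fin, Nat.cast_pow] at hB4
    rw [hcard, div_div, mul_comm (k : ℝ) 16] at hB3
    rw [one_mul] at hB2
    set B2 := {q : Fin m → P | cost P A < _}
    set B3 := ⋃ a, {q : Fin m → P | e ^ 2 / k * cost P A < _}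
    set B4 := ⋃ a, {q : Fin m → P | e * cost P (rep a) < _}
    refine le_trans ?_ (one_sub_le_productProb hμ (sum_samplingProb hP)
      (B := B1 ∪ B2 ∪ B3 ∪ B4) ?_)
    · have u1 := productProb_union_le hμ (B1 ∪ B2 ∪ B3) B4
      have u2 := productProb_union_le hμ (B1 ∪ B2) B3
      have u3 := productProb_union_le hμ B1 B2
      linarith
    · intro q hq
      by_contra hqB
      simp only [Set.mem_union, not_or] at hqB
      obtain ⟨⟨⟨q1, q2⟩, q3⟩, q4⟩ := hqB
      refine hq (isCoreset_of_estimates hγ he he1 hA hσ hEP hEm hE _ _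
        (fun i => sampleWeight_nonneg (q i).2) (fun i => (q i).2) (hgood1 q q1) ?_ (fun a => ?_)
        fun S => ⟨rep fun l => θ (S l), (hrep S).1, (hrep S).2, ?_⟩)
      · refine not_lt.1 fun h => q2 ?_
        show cost P A < _
        rw [← hsum]
        refine lt_of_lt_of_eq h ?_
        congr 2
        exact Finset.sum_congr rfl fun i _ => by rw [Set.indicator_of_mem (show (q i : X) ∈ (P : Set X) from (q i).2)]
      · exact not_lt.1 fun h => q3 (Set.mem_iUnion.2 ⟨a, h⟩)
      · exact not_lt.1 fun h => q4 (Set.mem_iUnion.2 ⟨_, h⟩)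

end Failure

/-! ### Choice of parameters -/

/-- With x = 2k/e, the factor for nearest center and scale is at most x², and the cover has at most
x^(4D) cells because 12/e³ ≤ (2/e)⁴. -/
theorem card_classes_le {k D n : ℕ} {e : ℝ} (hk : 1 ≤ k) (hD : 1 ≤ D) (he : 0 < e) (he1 : e < 1)
    (hn : (2 : ℝ) ^ n ≤ 12 / e ^ 3) :
    ((k * ((⌈k / e ^ 2⌉₊ + 1) * 2 ^ (D * n)) : ℕ) : ℝ)
      ≤ Real.exp (6 * (D * Real.log (2 * k / e))) := by
  have hk' : (1 : ℝ) ≤ k := by exact_mod_cast hk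
  have hD' : (1 : ℝ) ≤ D := by exact_mod_cast hD
  set x : ℝ := 2 * k / e with hx
  have hx2 : 2 / e ≤ x := by rw [hx]; gcongr; linarith
  have hx1 : 1 ≤ x := by
    refine le_trans ?_ hx2
    rw [le_div_iff₀ he]; linarith
  have hexp : Real.exp (6 * (D * Real.log x)) = x ^ (6 * D) := by
    rw [← Real.exp_log (by linarith : 0 < x), Real.log_exp, ← Real.exp_nat_mul]
    push_cast
    ring_nf
  rw [hexp]
  have h1 : (k : ℝ) * (⌈k / e ^ 2⌉₊ + 1) ≤ x ^ 2 := by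
    have h2 := Nat.ceil_lt_add_one (by positivity : 0 ≤ (k : ℝ) / e ^ 2)
    have h3 : 1 ≤ (k : ℝ) / e ^ 2 := by
      rw [le_div_iff₀ (by positivity)]
      nlinarith
    have h4 : x ^ 2 = k * (4 * (k / e ^ 2)) := by rw [hx]; field_simp; ring
    rw [h4]
    exact mul_le_mul_of_nonneg_left (by linarith) (by linarith)
  have h5 : (2 : ℝ) ^ (D * n) ≤ x ^ (4 * D) := by
    rw [mul_comm D n, pow_mul, pow_mul x]
    refine pow_le_pow_left₀ (by positivity) (hn.trans ?_) D
    refine le_trans ?_ (pow_le_pow_left₀ (by positivity) hx2 4)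
    rw [div_pow, div_le_div_iff₀ (by positivity) (by positivity)]
    have h6 : 0 < e ^ 3 := by positivity
    nlinarith
  have h7 : x ^ 2 ≤ x ^ (2 * D) := pow_le_pow_right₀ hx1 (by omega)
  push_cast
  rw [← mul_assoc, show 6 * D = 2 * D + 4 * D by ring, pow_add]
  exact mul_le_mul (h1.trans h7) h5 (by positivity) (by positivity)

/-- Sensitivity sampling fails with probability at most `δ` if the number of samples is large. -/
theorem one_sub_le_sampleProbability {X : Type*} [MetricSpace X] {k D m : ℕ} [NeZero k]
    {P : Finset X} {A : Fin k → X} {σ : X → Fin k} {e γ δ : ℝ} (hX : BallsCovered X D)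
    (hD : 1 ≤ D) (hP : P.Nonempty) (hγ : 1 ≤ γ) (hδ : 0 < δ) (hδ1 : δ < 1)
    (he : 0 < e) (he1 : e < 1) (hA : IsApproxSolution γ P A) (hσ : IsNearestAssignment P A σ)
    (hm : 544 * γ ^ 2 * (6 + Real.log (8 / δ) / Real.log 2) * (k * (D * Real.log (2 * k / e)))
      ≤ m * e ^ 2) :
    1 - δ ≤ sampleProbability P A σ m {q | IsCoreset k (256 * γ * e) P (fun i => (q i : X))
        (fun i => sampleWeight P A σ m (q i))} := by
  have hk1 : 1 ≤ k := Nat.pos_of_ne_zero (NeZero.ne k)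
  have hk' : (1 : ℝ) ≤ k := by exact_mod_cast hk1
  have hD' : (1 : ℝ) ≤ D := by exact_mod_cast hD
  have hk0 : (0 : ℝ) < k := by linarith
  obtain ⟨n, hn1, hn2⟩ := exists_nat_pow_near
    (x := 6 / e ^ 3) (y := 2) (by
      rw [le_div_iff₀ (by positivity)]
      have := pow_le_one₀ he.le he1.le (n := 3)
      linarith) one_lt_two
  have hn3 : (2 : ℝ) ^ (n + 1) ≤ 12 / e ^ 3 := by
    rw [pow_succ, show 12 / e ^ 3 = 6 / e ^ 3 * 2 by ring]
    linarith
  have hcard := card_classes_le hk1 hD he he1 hn3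
  refine le_trans ?_ (sampleProbability_ge hX hP hγ he he1 hA hσ (Nat.le_ceil (k / e ^ 2)) hn2.le
    rfl)
  set M := k * ((⌈k / e ^ 2⌉₊ + 1) * 2 ^ (D * (n + 1))) with hM
  set L := Real.log (2 * k / e) with hL
  set ℓ := Real.log (8 / δ) / Real.log 2 with hℓ
  have hlog2 : 0 < Real.log 2 := Real.log_pos one_lt_two
  have hL2 : Real.log 2 ≤ L := by
    refine Real.log_le_log two_pos ?_
    rw [le_div_iff₀ he]; nlinarith
  have hL0 : 0 < L := by linarith
  have hDL : Real.log 2 ≤ D * L := hL2.trans (le_mul_of_one_le_left hL0.le hD')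
  have hδ8 : 0 < Real.log (8 / δ) := Real.log_pos (by rw [lt_div_iff₀ hδ]; linarith)
  have hℓ0 : 0 < ℓ := div_pos hδ8 hlog2
  -- In the factor 6 + ℓ, the 6 pays for the number of classes and ℓ turns log(8/δ) into a multiple
  -- of the logarithmic term. Each of the four failure terms is then at most 2·δ/8.
  have hℓW : ∀ W, Real.log 2 ≤ W → Real.log (8 / δ) ≤ ℓ * W := by
    intro W hW
    have : Real.log (8 / δ) = ℓ * Real.log 2 := by rw [hℓ]; field_simp
    rw [this]
    exact mul_le_mul_of_nonneg_left hW hℓ0.le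
  have hexp : ∀ y, Real.log (8 / δ) ≤ y → Real.exp (-y) ≤ δ / 8 := by
    intro y hy
    rw [← Real.log_le_log_iff (Real.exp_pos _) (by positivity), Real.log_exp,
      ← inv_div, Real.log_inv]
    linarith
  have hγ2 : 1 ≤ γ ^ 2 := one_le_pow₀ hγ
  have hkM : (k : ℝ) ≤ M := by
    rw [hM]
    exact_mod_cast Nat.le_mul_of_pos_right k (by positivity)
  have hDL0 : 0 < D * L := by positivity
  have hkDL : D * L ≤ k * (D * L) := le_mul_of_one_le_left hDL0.le hk'
  have hbase : 544 * ((6 + ℓ) * (k * (D * L))) ≤ m * e ^ 2 := by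
    refine le_trans ?_ hm
    have : 0 ≤ (6 + ℓ) * (k * (D * L)) := by positivity
    nlinarith
  have t1 : M * Real.exp (-(m * (e ^ 2 / (16 * k)))) ≤ δ / 8 := by
    have h1 : (6 + ℓ) * (D * L) ≤ m * (e ^ 2 / (16 * k)) := by
      rw [← mul_div_assoc, le_div_iff₀ (by positivity)]
      have : 0 ≤ (6 + ℓ) * (k * (D * L)) := by positivity
      linarith
    refine (mul_le_mul hcard (Real.exp_le_exp.2 (neg_le_neg h1)) (Real.exp_pos _).le
      (Real.exp_pos _).le).trans ?_
    rw [← Real.exp_add]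
    refine (le_of_eq ?_).trans (hexp _ (hℓW _ hDL))
    congr 1
    ring
  have t0 : k * Real.exp (-(m * (e ^ 2 / (16 * k)))) ≤ δ / 8 :=
    (mul_le_mul_of_nonneg_right hkM (Real.exp_pos _).le).trans t1
  have t2 : Real.exp (-(m * (1 / 16 : ℝ))) ≤ δ / 8 := by
    refine hexp _ ((hℓW _ (hDL.trans hkDL)).trans ?_)
    have h1 : (m : ℝ) * e ^ 2 ≤ m * 1 :=
      mul_le_mul_of_nonneg_left (pow_le_one₀ he.le he1.le) (Nat.cast_nonneg _)
    have : 0 ≤ k * (D * L) := by positivity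
    have : 0 ≤ ℓ * (k * (D * L)) := by positivity
    linarith
  have t3 : (M : ℝ) ^ k * Real.exp (-(m * (e ^ 2 / (544 * γ ^ 2)))) ≤ δ / 8 := by
    have h1 : (6 + ℓ) * (k * (D * L)) ≤ m * (e ^ 2 / (544 * γ ^ 2)) := by
      rw [← mul_div_assoc, le_div_iff₀ (by positivity)]
      linarith
    have h2 := pow_le_pow_left₀ (Nat.cast_nonneg M) hcard k
    rw [← Real.exp_nat_mul] at h2
    refine (mul_le_mul h2 (Real.exp_le_exp.2 (neg_le_neg h1)) (Real.exp_pos _).le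
      (Real.exp_pos _).le).trans ?_
    rw [← Real.exp_add]
    refine (le_of_eq ?_).trans (hexp _ (hℓW _ (hDL.trans hkDL)))
    congr 1
    ring
  linarith

/-- In a one-point space all costs vanish. -/
theorem sampleProbability_eq_one_of_subsingleton {X : Type*} [MetricSpace X] {k m : ℕ} [NeZero k]
    {P : Finset X} {A : Fin k → X} {σ : X → Fin k} {ε : ℝ} (hX : ∀ x y : X, x = y)
    (hP : P.Nonempty) :
    sampleProbability P A σ m {q | IsCoreset k ε P (fun i => (q i : X))
        (fun i => sampleWeight P A σ m (q i))} = 1 := by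
  have h0 : ∀ (S : Fin k → X) (p : X), pointCost S p = 0 := by
    intro S p
    have h1 := minDist_le S p 0
    rw [hX p (S 0), dist_self] at h1
    rw [pointCost_eq, hX p (S 0), le_antisymm h1 (minDist_nonneg _ _)]
    norm_num
  have : {q : Fin m → P | IsCoreset k ε P (fun i => (q i : X))
        (fun i => sampleWeight P A σ m (q i))} = Set.univ := by
    refine Set.eq_univ_of_forall fun q S => ?_
    simp [cost, h0]
  rw [this]
  exact productProb_univ (sum_samplingProb hP)

end KMeans
end

theorem theorem4 :
    ∃ c : ℕ, ∀ γ δ : ℝ, 1 ≤ γ → 0 < δ → δ < 1 → ∃ C : ℝ, 0 < C ∧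
      ∀ (X : Type*) [MetricSpace X] (D k : ℕ) (ε : ℝ) (P : Finset X) (A : Fin k → X)
        (σ : X → Fin k) (m : ℕ),
        doublingDim X ≤ D → 1 ≤ k → 0 < ε → ε < 1 → P.Nonempty →
        IsApproxSolution γ P A → IsNearestAssignment P A σ →
        C * k * D * Real.log (2 * k / ε) ^ c / ε ^ 2 ≤ m →
        1 - δ ≤ sampleProbability P A σ m
          {q | IsCoreset k ε P (fun i => (q i : X)) (fun i => sampleWeight P A σ m (q i))} := by
  refine ⟨1, fun γ δ hγ hδ hδ1 => ?_⟩
  have hlog2 : 0 < Real.log 2 := Real.log_pos one_lt_two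
  have hδ8 : 0 < Real.log (8 / δ) := Real.log_pos (by rw [lt_div_iff₀ hδ]; linarith)
  have hK : 1 < 256 * γ := by linarith
  have hlogK : 0 < Real.log (256 * γ) := Real.log_pos hK
  set C₀ := 544 * γ ^ 2 * (6 + Real.log (8 / δ) / Real.log 2) with hC₀
  have hC₀pos : 0 < C₀ := by positivity
  refine ⟨(256 * γ) ^ 2 * C₀ * (1 + Real.log (256 * γ) / Real.log 2), by positivity, ?_⟩
  intro X _ D k ε P A σ m hD hk hε hε1 hP hA hσ hm
  have : NeZero k := ⟨by omega⟩
  have hX := ballsCovered_of_doublingDim_le hD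
  rcases Nat.eq_zero_or_pos D with rfl | hD1
  · rw [sampleProbability_eq_one_of_subsingleton hX.subsingleton hP]
    linarith
  have hk' : (1 : ℝ) ≤ k := by exact_mod_cast hk
  -- Undoes the loss 256γ of the coreset criterion. As log(2k/ε) ≥ log 2, the additional log(256γ)
  -- is absorbed into the constant.
  set e := ε / (256 * γ) with he
  have hεe : 256 * γ * e = ε := by rw [he]; field_simp
  have he0 : 0 < e := by positivity
  have he1 : e < 1 := by rw [he, div_lt_one (by positivity)]; linarith
  rw [← hεe]
  refine one_sub_le_sampleProbability hX hD1 hP hγ hδ hδ1 he0 he1 hA hσ ?_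
  rw [← hC₀]
  have hx2 : 2 ≤ 2 * k / ε := by rw [le_div_iff₀ hε]; nlinarith
  have hL2 : Real.log 2 ≤ Real.log (2 * k / ε) := Real.log_le_log two_pos hx2
  have hlog : Real.log (2 * k / e)
      ≤ (1 + Real.log (256 * γ) / Real.log 2) * Real.log (2 * k / ε) := by
    have h1 : 2 * k / e = 2 * k / ε * (256 * γ) := by rw [he]; field_simp
    rw [h1, Real.log_mul (by positivity) (by positivity), add_mul, one_mul]
    have h2 : Real.log (256 * γ) = Real.log (256 * γ) / Real.log 2 * Real.log 2 := by
      field_simp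
    have h3 := mul_le_mul_of_nonneg_left hL2 (div_pos hlogK hlog2).le
    linarith
  rw [pow_one, div_le_iff₀ (by positivity)] at hm
  have h4 : (m : ℝ) * e ^ 2 = m * ε ^ 2 / (256 * γ) ^ 2 := by rw [he]; ring
  rw [h4, le_div_iff₀ (by positivity)]
  refine le_trans ?_ hm
  have h5 : C₀ * (k * (D * Real.log (2 * k / e))) * (256 * γ) ^ 2
      = (256 * γ) ^ 2 * C₀ * k * D * Real.log (2 * k / e) := by ring
  rw [h5]
  refine (mul_le_mul_of_nonneg_left hlog (by positivity)).trans (le_of_eq ?_)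
  ring
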